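/- For $k=2^l-1$ let $\mathit{CBT}_k$ be the complete binary tree with $l$ levels and $k$ vertices. Let $k_1\ge k_2\ge\cdots\ge k_d$ be integers of the form $k_i=2^{l_i}-1$ with $l_i\ge 2$ (so that every factor has at least one edge), and let $\mathit{MCT}^{(d)}_{k_1,\ldots,k_d}=\mathit{CBT}_{k_1}\times\cdots\times\mathit{CBT}_{k_d}$ be the $d$-dimensional mesh-connected trees, where $\times$ denotes the Cartesian product of graphs (two vertices are adjacent when they differ in exactly one coordinate $i$ and their $i$-th coordinates are adjacent in $\mathit{CBT}_{k_i}$). For a graph $G$ with $n$ vertices, let the bisection width $BW(G)$ be the minimum, over all sets $S$ of $\lfloor n/2\rfloor$ vertices, of the number of edges of $G$ with exactly one endpoint in $S$. Then $$BW\bigl(\mathit{MCT}^{(d)}_{k_1,\ldots,k_d}\bigr)=\Psi(d),\qquad\text{where}\qquad \Psi(d)=\sum_{i=1}^{d}\ \prod_{j=i+1}^{d}k_j .$$ -/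

import Mathlib

open Finset

/-- The complete binary tree on `k` vertices, for `k = 2 ^ l - 1` (that is, with `l` full levels),
with vertices in breadth-first order: the root is `0`, and the children of `u` are `2 * u + 1` and
`2 * u + 2`. -/
def completeBinaryTree (k : ℕ) : SimpleGraph (Fin k) where
  Adj u v :=
    (v.val = 2 * u.val + 1 ∨ v.val = 2 * u.val + 2) ∨
      (u.val = 2 * v.val + 1 ∨ u.val = 2 * v.val + 2)
  symm := ⟨fun _ _ h => h.symm⟩
  loopless := ⟨fun u h => by omega⟩

/-- The Cartesian product of a family of graphs: two vertices are adjacent when they differ in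
exactly one coordinate `i`, and there they are adjacent in `G i`. -/
def cartesianProduct {ι : Type*} {V : ι → Type*} (G : ∀ i, SimpleGraph (V i)) :
    SimpleGraph (∀ i, V i) where
  Adj x y := ∃ i, (G i).Adj (x i) (y i) ∧ ∀ j, j ≠ i → x j = y j
  symm := ⟨fun _ _ ⟨i, hi, h⟩ => ⟨i, hi.symm, fun j hj => (h j hj).symm⟩⟩
  loopless := ⟨fun _ ⟨_, hi, _⟩ => hi.ne rfl⟩

/-- The `d`-dimensional mesh-connected trees: the Cartesian product of the complete binary trees
on `k i` vertices. -/
def meshConnectedTrees {d : ℕ} (k : Fin d → ℕ) : SimpleGraph (∀ i, Fin (k i)) :=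
  cartesianProduct fun i => completeBinaryTree (k i)

/-- The set of edges of `G` with one endpoint in `S` and the other outside `S`. -/
def edgeBoundary {V : Type*} (G : SimpleGraph V) (S : Finset V) : Set (Sym2 V) :=
  {e | e ∈ G.edgeSet ∧ ∃ u ∈ S, ∃ v ∉ S, e = s(u, v)}

/-- The sizes of the edge boundaries of the bisections of `G`, that is, of the sets of `⌊n / 2⌋`
vertices, where `n` is the number of vertices of `G`. -/
def bisectionSizes {V : Type*} [Fintype V] (G : SimpleGraph V) : Set ℕ :=
  {m | ∃ S : Finset V, S.card = Fintype.card V / 2 ∧ (edgeBoundary G S).ncard = m}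

/-- The bisection width: the least number of edges whose removal separates a set of `⌊n / 2⌋`
vertices from the remaining ones. -/
noncomputable def bisectionWidth {V : Type*} [Fintype V] (G : SimpleGraph V) : ℕ :=
  sInf (bisectionSizes G)

/-- The infimum in the definition of the bisection width is attained. -/
theorem isLeast_bisectionWidth {V : Type*} [Fintype V] (G : SimpleGraph V) :
    IsLeast (bisectionSizes G) (bisectionWidth G) := by
  have hne : (bisectionSizes G).Nonempty := by
    obtain ⟨S, _, hS⟩ := Finset.exists_subset_card_eq (s := (Finset.univ : Finset V))
      (n := Fintype.card V / 2) (by rw [Finset.card_univ]; exact Nat.div_le_self _ _)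
    exact ⟨_, S, hS, rfl⟩
  exact ⟨Nat.sInf_mem hne, fun m hm => Nat.sInf_le hm⟩

/-- `Psi k a = ∑_{i = 1}^{a} ∏_{j = i + 1}^{d} k_j`, where the dimensions `1, …, d` are numbered
`0, …, d - 1`. -/
def Psi {d : ℕ} (k : Fin d → ℕ) (a : ℕ) : ℕ :=
  ∑ i : Fin d with i.val < a, ∏ j : Fin d with i < j, k j

/-! Lower bound. Removing an edge from a tree on an odd number k of vertices leaves parts of sizes s
and k - s with s(k - s) ≤ (k² - 1)/4. Joining all pairs of vertices by tree paths shows that a set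
of c vertices, which separates c(k - c) pairs, cuts at least 4c(k - c)/(k² - 1) tree edges
(`cliqueCut_le_treeCut`). Summed over all lines of the product, the tree boundary is at least the
boundary in a product of complete graphs with edge weights 4/(k_i² - 1)
(`cliqueEnergy_le_treeEnergy`). There, with the larger factors first, lexicographic initial segments
minimize the boundary (`belowOptimal_of_pairwise`). The initial segment with half of the vertices
meets each line in the first direction in (k - 1)/2 or (k + 1)/2 points, so each such line costs
exactly 1; the rest of the boundary is that of the half segment in the middle slice. This recursion
gives Ψ(d) (`cliqueEnergy_below_half`).

Upper bound. All slices over one subtree of the root, together with a recursively chosen half of the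
slice over the root, form a bisection that cuts one edge per line in the first direction, again Ψ(d)
in total (`exists_bisection`).

Isoperimetry is proved by induction on the number of factors. With three or more, slices with a
fixed first or last coordinate are compressed to initial segments. A set stable under both
compressions is an initial segment, or differs from one only near the border of two consecutive
slices, and that case is compared directly (`belowOptimal_of_compression`). With two factors, the
problem becomes an inequality for the pairwise differences of the column sizes, which follows from
an isoperimetric inequality in ℤ/h (`belowOptimal_pair`, `cyclic_isoperimetry`). -/

/-! ### Boundaries in weighted products of complete graphs -/

/-- The indicator function of the initial segment `{0, …, m - 1}`. -/
def below (m : ℕ) : ℕ → ℕ := fun x => if x < m then 1 else 0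

/-- The normalized edge boundary of a set of `c` vertices in the complete graph on `k` vertices. -/
def cliqueCut (k c : ℕ) : ℚ := 4 / ((k : ℚ) ^ 2 - 1) * (c * (k - c))

/-- The dimension-normalized edge boundary in the product of the complete graphs whose orders are
listed, of the set with indicator function `f`. The vertices are numbered lexicographically. -/
def cliqueEnergy : List ℕ → (ℕ → ℕ) → ℚ
  | [], _ => 0
  | k :: ks, f => ∑ a ∈ range k, cliqueEnergy ks (fun y => f (a * ks.prod + y)) +
      ∑ y ∈ range ks.prod, cliqueCut k (∑ a ∈ range k, f (a * ks.prod + y))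

theorem below_le_one (m x : ℕ) : below m x ≤ 1 := by
  unfold below; split_ifs <;> simp

theorem sum_below {m N : ℕ} (h : m ≤ N) : ∑ x ∈ range N, below m x = m := by
  unfold below
  rw [← Finset.sum_filter]
  have : (range N).filter (fun x => x < m) = range m := by
    ext x; simp; omega
  simp [this]

theorem sum_le_of_le_one {f : ℕ → ℕ} (hf : ∀ x, f x ≤ 1) (N : ℕ) : ∑ x ∈ range N, f x ≤ N := by
  calc ∑ x ∈ range N, f x ≤ ∑ x ∈ range N, 1 := Finset.sum_le_sum fun x _ => hf x
    _ = N := by simp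

theorem sum_range_mul_eq {M : Type*} [AddCommMonoid M] (a b : ℕ) (F : ℕ → M) :
    ∑ x ∈ range (a * b), F x = ∑ i ∈ range a, ∑ j ∈ range b, F (i * b + j) := by
  induction a with
  | zero => simp
  | succ a ih => rw [Nat.succ_mul, Finset.sum_range_add, ih, Finset.sum_range_succ]

theorem index_lt {k N a y : ℕ} (ha : a < k) (hy : y < N) : a * N + y < k * N := by
  calc a * N + y < a * N + N := by omega
    _ = (a + 1) * N := by ring
    _ ≤ k * N := Nat.mul_le_mul_right _ ha

theorem cliqueEnergy_congr {ks : List ℕ} {f g : ℕ → ℕ} (h : ∀ x < ks.prod, f x = g x) :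
    cliqueEnergy ks f = cliqueEnergy ks g := by
  induction ks generalizing f g with
  | nil => rfl
  | cons k ks ih =>
    rw [List.prod_cons] at h
    unfold cliqueEnergy
    congr 1
    · refine Finset.sum_congr rfl fun a ha => ih fun y hy => h _ (index_lt (by simpa using ha) hy)
    · refine Finset.sum_congr rfl fun y hy => ?_
      congr 1
      exact Finset.sum_congr rfl fun a ha => h _ (index_lt (by simpa using ha) (by simpa using hy))

theorem cliqueCut_zero (k : ℕ) : cliqueCut k 0 = 0 := by simp [cliqueCut]

theorem cliqueCut_self (k : ℕ) : cliqueCut k k = 0 := by simp [cliqueCut]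

theorem cliqueEnergy_zero (ks : List ℕ) : cliqueEnergy ks (fun _ => 0) = 0 := by
  induction ks with
  | nil => rfl
  | cons k ks ih => simp [cliqueEnergy, ih, cliqueCut_zero]

theorem cliqueEnergy_one (ks : List ℕ) : cliqueEnergy ks (fun _ => 1) = 0 := by
  induction ks with
  | nil => rfl
  | cons k ks ih => simp [cliqueEnergy, ih, cliqueCut_self]

theorem cliqueEnergy_below_zero (ks : List ℕ) : cliqueEnergy ks (below 0) = 0 := by
  rw [← cliqueEnergy_zero ks]; exact cliqueEnergy_congr fun x _ => by simp [below]

theorem cliqueEnergy_below_prod (ks : List ℕ) : cliqueEnergy ks (below ks.prod) = 0 := by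
  rw [← cliqueEnergy_one ks]; exact cliqueEnergy_congr fun x hx => by simp [below, hx]

/-- The energy of a set all of whose slices in the first coordinate are initial segments. -/
theorem cliqueEnergy_cons_of_slices {k : ℕ} {ks : List ℕ} {f : ℕ → ℕ} (m : ℕ → ℕ)
    (hf : ∀ a < k, ∀ y < ks.prod, f (a * ks.prod + y) = below (m a) y) :
    cliqueEnergy (k :: ks) f = ∑ a ∈ range k, cliqueEnergy ks (below (m a)) +
      ∑ y ∈ range ks.prod, cliqueCut k (∑ a ∈ range k, below (m a) y) := by
  rw [cliqueEnergy]
  congr 1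
  · exact Finset.sum_congr rfl fun a ha => cliqueEnergy_congr fun y hy =>
      hf a (by simpa using ha) y hy
  · refine Finset.sum_congr rfl fun y hy => ?_
    congr 1
    exact Finset.sum_congr rfl fun a ha => hf a (by simpa using ha) y (by simpa using hy)

/-- Energy splits along the last coordinate as well. -/
theorem cliqueEnergy_append (ks : List ℕ) (h : ℕ) (f : ℕ → ℕ) :
    cliqueEnergy (ks ++ [h]) f = ∑ c ∈ range h, cliqueEnergy ks (fun z => f (z * h + c)) +
      ∑ z ∈ range ks.prod, cliqueCut h (∑ c ∈ range h, f (z * h + c)) := by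
  induction ks generalizing f with
  | nil => simp [cliqueEnergy]
  | cons k ks ih =>
    rw [List.cons_append, cliqueEnergy]
    simp only [ih, cliqueEnergy]
    simp only [List.prod_append, List.prod_cons, List.prod_nil, mul_one, sum_add_distrib,
      sum_range_mul_eq]
    have key : ∀ a z c, a * (ks.prod * h) + (z * h + c) = (a * ks.prod + z) * h + c := by
      intros; ring
    simp only [key]
    rw [Finset.sum_comm (s := range h) (t := range k), Finset.sum_comm (s := range h)]
    ring

/-- The energy of an initial segment, by the number of full slices and the remainder. -/
theorem cliqueEnergy_cons_below {k : ℕ} {ks : List ℕ} {q r : ℕ} (hq : q < k) (hr : r ≤ ks.prod) :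
    cliqueEnergy (k :: ks) (below (q * ks.prod + r)) = cliqueEnergy ks (below r) +
      (r * cliqueCut k (q + 1) + (ks.prod - r) * cliqueCut k q) := by
  set N := ks.prod with hN
  let m : ℕ → ℕ := fun a => if a < q then N else if a = q then r else 0
  rw [cliqueEnergy_cons_of_slices m]
  · congr 1
    · rw [Finset.sum_eq_single_of_mem q (by simpa using hq)]
      · simp [m]
      · intro a _ haq
        by_cases h : a < q
        · simp only [m, h, if_true]; exact cliqueEnergy_below_prod ks
        · simp only [m, h, haq, if_false]; exact cliqueEnergy_below_zero ks
    · have hc : ∀ y ∈ range N, ∑ a ∈ range k, below (m a) y = q + below r y := by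
        intro y hy
        have hy' : y < N := by simpa using hy
        obtain ⟨e, rfl⟩ : ∃ e, k = q + (1 + e) := ⟨k - q - 1, by omega⟩
        rw [Finset.sum_range_add, Finset.sum_range_add]
        have h1 : ∑ x ∈ range q, below (m x) y = q := by
          rw [Finset.sum_congr rfl (g := fun _ => 1)]
          · simp
          · intro x hx
            have : x < q := by simpa using hx
            simp [m, this, below, hy']
        have h2 : ∑ x ∈ range e, below (m (q + (1 + x))) y = 0 := by
          refine Finset.sum_eq_zero fun x _ => ?_
          have h3 : ¬ (q + (1 + x) < q) := by omega
          simp [m, below]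
        rw [h1, h2]; simp [m]
      rw [← hN, Finset.sum_congr rfl fun y hy => by rw [hc y hy]]
      obtain ⟨e, he⟩ : ∃ e, N = r + e := ⟨N - r, by omega⟩
      rw [he, Finset.sum_range_add]
      have h1 : ∀ x ∈ range r, cliqueCut k (q + below r x) = cliqueCut k (q + 1) := by
        intro x hx; have : x < r := by simpa using hx
        simp [below, this]
      have h2 : ∀ x ∈ range e, cliqueCut k (q + below r (r + x)) = cliqueCut k q := by
        intro x hx; simp [below]
      rw [Finset.sum_congr rfl h1, Finset.sum_congr rfl h2]
      simp
  · intro a ha y hy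
    rw [← hN] at hy ⊢
    simp only [m, below]
    have key : (a * N + y < q * N + r) ↔ (y < if a < q then N else if a = q then r else 0) := by
      split_ifs with h1 h2
      · have := index_lt h1 hy
        constructor
        · intro _; exact hy
        · intro _; omega
      · subst h2; omega
      · have h3 : q + 1 ≤ a := by omega
        have := Nat.mul_le_mul_right N h3
        rw [Nat.succ_mul] at this
        constructor
        · intro _; omega
        · intro h; omega
    simp only [key]

/-! ### Compression of slices to initial segments -/

theorem sum_mul_le_min {f g : ℕ → ℕ} (hf : ∀ x, f x ≤ 1) (hg : ∀ x, g x ≤ 1) (N : ℕ) :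
    ∑ x ∈ range N, f x * g x ≤ min (∑ x ∈ range N, f x) (∑ x ∈ range N, g x) := by
  refine le_min (Finset.sum_le_sum fun x _ => ?_) (Finset.sum_le_sum fun x _ => ?_)
  · exact (Nat.mul_le_mul_left _ (hg x)).trans (by simp)
  · exact (Nat.mul_le_mul_right _ (hf x)).trans (by simp)

theorem sum_below_mul_below {m n N : ℕ} (hm : m ≤ N) (hn : n ≤ N) :
    ∑ x ∈ range N, below m x * below n x = min m n := by
  rw [← sum_below (m := min m n) (N := N) (by omega)]
  refine Finset.sum_congr rfl fun x _ => ?_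
  unfold below
  split_ifs <;> first | rfl | omega

theorem sum_sq_eq_sum_mul (F : ℕ → ℕ → ℕ) (k N : ℕ) :
    ∑ y ∈ range N, (∑ a ∈ range k, F a y) ^ 2 =
      ∑ a ∈ range k, ∑ b ∈ range k, ∑ y ∈ range N, F a y * F b y := by
  simp only [sq, Finset.sum_mul_sum]
  rw [Finset.sum_comm]
  refine Finset.sum_congr rfl fun a _ => ?_
  rw [Finset.sum_comm]

theorem sum_sq_le_sum_min {F : ℕ → ℕ → ℕ} (hF : ∀ a y, F a y ≤ 1) (k N : ℕ) :
    ∑ y ∈ range N, (∑ a ∈ range k, F a y) ^ 2 ≤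
      ∑ a ∈ range k, ∑ b ∈ range k,
        min (∑ y ∈ range N, F a y) (∑ y ∈ range N, F b y) := by
  rw [sum_sq_eq_sum_mul]
  exact Finset.sum_le_sum fun a _ => Finset.sum_le_sum fun b _ => sum_mul_le_min (hF a) (hF b) N

theorem cliqueCut_coeff_nonneg {k : ℕ} (hk : 1 ≤ k) : (0 : ℚ) ≤ 4 / ((k : ℚ) ^ 2 - 1) := by
  have : (1 : ℚ) ≤ k := by exact_mod_cast hk
  apply div_nonneg <;> nlinarith

theorem sum_cliqueCut_eq (k N : ℕ) (c : ℕ → ℕ) :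
    ∑ y ∈ range N, cliqueCut k (c y) = 4 / ((k : ℚ) ^ 2 - 1) *
      (k * ((∑ y ∈ range N, c y : ℕ) : ℚ) - ((∑ y ∈ range N, c y ^ 2 : ℕ) : ℚ)) := by
  unfold cliqueCut
  rw [← Finset.mul_sum]
  push_cast
  rw [Finset.mul_sum (a := (k : ℚ)), ← Finset.sum_sub_distrib]
  congr 1
  exact Finset.sum_congr rfl fun y _ => by ring

/-- Replacing each slice by an initial segment does not increase the cut across the slices. -/
theorem sum_cliqueCut_below_le {k : ℕ} (hk : 1 ≤ k) {F : ℕ → ℕ → ℕ} (hF : ∀ a y, F a y ≤ 1)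
    (N : ℕ) :
    ∑ y ∈ range N, cliqueCut k (∑ a ∈ range k, below (∑ z ∈ range N, F a z) y) ≤
      ∑ y ∈ range N, cliqueCut k (∑ a ∈ range k, F a y) := by
  rw [sum_cliqueCut_eq, sum_cliqueCut_eq]
  refine mul_le_mul_of_nonneg_left ?_ (cliqueCut_coeff_nonneg hk)
  have h1 : ∑ y ∈ range N, ∑ a ∈ range k, below (∑ z ∈ range N, F a z) y =
      ∑ y ∈ range N, ∑ a ∈ range k, F a y := by
    rw [Finset.sum_comm, Finset.sum_comm (s := range N)]
    exact Finset.sum_congr rfl fun a _ => sum_below (sum_le_of_le_one (hF a) N)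
  rw [h1]
  -- The cut is a linear term minus a sum of squares, and the squares count overlaps of pairs of
  -- slices. Nested initial segments attain the largest possible overlap, the smaller of the two
  -- sizes.
  have h2 : ∑ y ∈ range N, (∑ a ∈ range k, F a y) ^ 2 ≤
      ∑ y ∈ range N, (∑ a ∈ range k, below (∑ z ∈ range N, F a z) y) ^ 2 := by
    refine (sum_sq_le_sum_min hF k N).trans_eq ?_
    rw [sum_sq_eq_sum_mul]
    refine Finset.sum_congr rfl fun a _ => Finset.sum_congr rfl fun b _ => ?_
    rw [sum_below_mul_below (sum_le_of_le_one (hF a) N) (sum_le_of_le_one (hF b) N)]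
  have h3 : ((∑ y ∈ range N, (∑ a ∈ range k, F a y) ^ 2 : ℕ) : ℚ) ≤
      ((∑ y ∈ range N, (∑ a ∈ range k, below (∑ z ∈ range N, F a z) y) ^ 2 : ℕ) : ℚ) := by
    exact_mod_cast h2
  linarith

/-- Both functions have sum m, so the weighted sums differ by the sum of `(y - m) * (f y - below m
y)`, in which no term is negative. An inversion has its zero below m or its one above m, and this
makes a term positive. -/
theorem sum_mul_below_le {f : ℕ → ℕ} (hf : ∀ x, f x ≤ 1) (N : ℕ) :
    ∑ y ∈ range N, y * below (∑ x ∈ range N, f x) y ≤ ∑ y ∈ range N, y * f y ∧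
    ((∃ y₁ y₂, y₁ < y₂ ∧ y₂ < N ∧ f y₁ = 0 ∧ f y₂ = 1) →
      ∑ y ∈ range N, y * below (∑ x ∈ range N, f x) y < ∑ y ∈ range N, y * f y) := by
  set m := ∑ x ∈ range N, f x with hm
  have hs := sum_below (sum_le_of_le_one hf N)
  rw [← hm] at hs
  have key : ((∑ y ∈ range N, y * f y : ℕ) : ℤ) - ((∑ y ∈ range N, y * below m y : ℕ) : ℤ) =
      ∑ y ∈ range N, ((y : ℤ) - m) * ((f y : ℤ) - below m y) := by
    have h0 : ∑ y ∈ range N, (m : ℤ) * ((f y : ℤ) - below m y) = 0 := by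
      rw [← Finset.mul_sum, Finset.sum_sub_distrib]
      have h1 : (∑ y ∈ range N, (f y : ℤ)) = m := by rw [hm]; push_cast; rfl
      have h2 : (∑ y ∈ range N, (below m y : ℤ)) = m := by exact_mod_cast hs
      rw [h1, h2]; simp
    simp only [sub_mul, Finset.sum_sub_distrib] at h0 ⊢
    rw [h0]
    push_cast
    simp only [mul_sub, Finset.sum_sub_distrib]
    ring
  have hterm : ∀ y : ℕ, 0 ≤ ((y : ℤ) - m) * ((f y : ℤ) - below m y) := by
    intro y
    have := hf y
    unfold below
    split_ifs with h
    · apply mul_nonneg_of_nonpos_of_nonpos <;> push_cast <;> omega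
    · apply mul_nonneg <;> push_cast <;> omega
  constructor
  · have := Finset.sum_nonneg (s := range N) fun y _ => hterm y
    rw [← key] at this
    omega
  · rintro ⟨y₁, y₂, h12, h2, hf1, hf2⟩
    have : 0 < ∑ y ∈ range N, ((y : ℤ) - m) * ((f y : ℤ) - below m y) := by
      by_cases h : y₁ < m
      · refine Finset.sum_pos' (fun y _ => hterm y) ⟨y₁, by simp; omega, ?_⟩
        simp only [below, h, hf1, if_true]
        push_cast; omega
      · refine Finset.sum_pos' (fun y _ => hterm y) ⟨y₂, by simp; omega, ?_⟩
        have : ¬ y₂ < m := by omega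
        simp only [below, this, hf2, if_false]
        push_cast; omega
    rw [← key] at this
    omega

/-- The affine weights are positions in the whole product: `a * N + y` in a slice with fixed first
coordinate, `c + h * z` in one with fixed last coordinate. -/
theorem sum_affine_mul_below_le {f : ℕ → ℕ} (hf : ∀ x, f x ≤ 1) (N α β : ℕ) :
    ∑ y ∈ range N, (α + β * y) * below (∑ x ∈ range N, f x) y ≤
      ∑ y ∈ range N, (α + β * y) * f y ∧
    (0 < β → (∃ y₁ y₂, y₁ < y₂ ∧ y₂ < N ∧ f y₁ = 0 ∧ f y₂ = 1) →
      ∑ y ∈ range N, (α + β * y) * below (∑ x ∈ range N, f x) y <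
        ∑ y ∈ range N, (α + β * y) * f y) := by
  have h := sum_mul_below_le hf N
  have hs := sum_below (sum_le_of_le_one hf N)
  simp only [add_mul, Finset.sum_add_distrib, mul_assoc, ← Finset.mul_sum, hs]
  exact ⟨Nat.add_le_add_left (Nat.mul_le_mul_left _ h.1) _, fun hβ hi =>
    Nat.add_lt_add_left (Nat.mul_lt_mul_of_pos_left (h.2 hi) hβ) _⟩

/-- The isoperimetric property: initial segments minimize the energy. -/
def BelowOptimal (ks : List ℕ) : Prop :=
  ∀ f : ℕ → ℕ, (∀ x, f x ≤ 1) →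
    cliqueEnergy ks (below (∑ x ∈ range ks.prod, f x)) ≤ cliqueEnergy ks f

/-- Every slice with fixed first coordinate becomes an initial segment of its size. The boundary
inside slices drops by optimality of `ks`, the boundary across them by nesting. The sum of positions
is a termination measure; it drops strictly because slice `a` has an inversion. -/
theorem exists_compression_cons {k : ℕ} {ks : List ℕ} (hk : 1 ≤ k) (hks : BelowOptimal ks)
    {f : ℕ → ℕ} (hf : ∀ x, f x ≤ 1) {a y₁ y₂ : ℕ} (ha : a < k) (h12 : y₁ < y₂)
    (h2 : y₂ < ks.prod) (hf1 : f (a * ks.prod + y₁) = 0) (hf2 : f (a * ks.prod + y₂) = 1) :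
    ∃ f' : ℕ → ℕ, (∀ x, f' x ≤ 1) ∧
      ∑ x ∈ range (k * ks.prod), f' x = ∑ x ∈ range (k * ks.prod), f x ∧
      ∑ x ∈ range (k * ks.prod), x * f' x < ∑ x ∈ range (k * ks.prod), x * f x ∧
      cliqueEnergy (k :: ks) f' ≤ cliqueEnergy (k :: ks) f := by
  set N := ks.prod with hN
  let m : ℕ → ℕ := fun a => ∑ y ∈ range N, f (a * N + y)
  let f' : ℕ → ℕ := fun x => below (m (x / N)) (x % N)
  have hm : ∀ a, m a ≤ N := fun a => sum_le_of_le_one (fun y => hf _) N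
  have hf' : ∀ a, ∀ y < N, f' (a * N + y) = below (m a) y := by
    intro a y hy
    simp only [f']
    rw [Nat.mul_add_mod', Nat.mod_eq_of_lt hy, show (a * N + y) / N = a by
      rw [mul_comm, Nat.mul_add_div (by omega), Nat.div_eq_of_lt hy, add_zero]]
  refine ⟨f', fun x => below_le_one _ _, ?_, ?_, ?_⟩
  · rw [sum_range_mul_eq, sum_range_mul_eq]
    refine Finset.sum_congr rfl fun a _ => ?_
    rw [Finset.sum_congr rfl fun y hy => hf' a y (by simpa using hy), sum_below (hm a)]
  · rw [sum_range_mul_eq, sum_range_mul_eq]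
    have key : ∀ b, ∑ y ∈ range N, (b * N + y) * f' (b * N + y) =
        ∑ y ∈ range N, (b * N + 1 * y) * below (m b) y := fun b =>
      Finset.sum_congr rfl fun y hy => by rw [hf' b y (by simpa using hy), one_mul]
    have key2 : ∀ b, ∑ y ∈ range N, (b * N + y) * f (b * N + y) =
        ∑ y ∈ range N, (b * N + 1 * y) * f (b * N + y) := fun b => by simp
    simp only [key, key2]
    refine Finset.sum_lt_sum (fun b _ => (sum_affine_mul_below_le (fun y => hf _) N _ _).1)
      ⟨a, by simpa using ha, ?_⟩
    exact (sum_affine_mul_below_le (f := fun y => f (a * N + y)) (fun y => hf _) N _ _).2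
      one_pos ⟨y₁, y₂, h12, h2, hf1, hf2⟩
  · rw [cliqueEnergy_cons_of_slices m fun a _ y hy => hf' a y hy, cliqueEnergy]
    exact add_le_add (Finset.sum_le_sum fun a _ => hks _ fun y => hf _)
      (sum_cliqueCut_below_le hk (F := fun a y => f (a * N + y)) (fun _ _ => hf _) N)

/-- The same compression for slices with fixed last coordinate, by way of `cliqueEnergy_append`. -/
theorem exists_compression_append {h : ℕ} {ks : List ℕ} (hh : 1 ≤ h) (hks : BelowOptimal ks)
    {f : ℕ → ℕ} (hf : ∀ x, f x ≤ 1) {c z₁ z₂ : ℕ} (hc : c < h) (h12 : z₁ < z₂)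
    (h2 : z₂ < ks.prod) (hf1 : f (z₁ * h + c) = 0) (hf2 : f (z₂ * h + c) = 1) :
    ∃ f' : ℕ → ℕ, (∀ x, f' x ≤ 1) ∧
      ∑ x ∈ range (ks.prod * h), f' x = ∑ x ∈ range (ks.prod * h), f x ∧
      ∑ x ∈ range (ks.prod * h), x * f' x < ∑ x ∈ range (ks.prod * h), x * f x ∧
      cliqueEnergy (ks ++ [h]) f' ≤ cliqueEnergy (ks ++ [h]) f := by
  set N := ks.prod with hN
  let m : ℕ → ℕ := fun c => ∑ z ∈ range N, f (z * h + c)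
  let f' : ℕ → ℕ := fun x => below (m (x % h)) (x / h)
  have hm : ∀ a, m a ≤ N := fun a => sum_le_of_le_one (fun y => hf _) N
  have hf' : ∀ c < h, ∀ z, f' (z * h + c) = below (m c) z := by
    intro c hc z
    simp only [f']
    rw [Nat.mul_add_mod', Nat.mod_eq_of_lt hc, show (z * h + c) / h = z by
      rw [mul_comm, Nat.mul_add_div (by omega), Nat.div_eq_of_lt hc, add_zero]]
  refine ⟨f', fun x => below_le_one _ _, ?_, ?_, ?_⟩
  · rw [sum_range_mul_eq, sum_range_mul_eq, Finset.sum_comm, Finset.sum_comm (s := range N)]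
    refine Finset.sum_congr rfl fun c hc => ?_
    rw [Finset.sum_congr rfl fun z _ => hf' c (by simpa using hc) z, sum_below (hm c)]
  · rw [sum_range_mul_eq, sum_range_mul_eq, Finset.sum_comm, Finset.sum_comm (s := range N)]
    have key : ∀ b ∈ range h, ∑ z ∈ range N, (z * h + b) * f' (z * h + b) =
        ∑ z ∈ range N, (b + h * z) * below (m b) z := fun b hb =>
      Finset.sum_congr rfl fun z _ => by rw [hf' b (by simpa using hb) z]; ring
    have key2 : ∀ b ∈ range h, ∑ z ∈ range N, (z * h + b) * f (z * h + b) =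
        ∑ z ∈ range N, (b + h * z) * f (z * h + b) := fun b _ =>
      Finset.sum_congr rfl fun z _ => by ring
    rw [Finset.sum_congr rfl key, Finset.sum_congr rfl key2]
    refine Finset.sum_lt_sum (fun b _ => (sum_affine_mul_below_le (fun y => hf _) N _ _).1)
      ⟨c, by simpa using hc, ?_⟩
    exact (sum_affine_mul_below_le (f := fun z => f (z * h + c)) (fun y => hf _) N _ _).2
      hh ⟨z₁, z₂, h12, h2, hf1, hf2⟩
  · rw [cliqueEnergy_append, cliqueEnergy_append]
    refine add_le_add (Finset.sum_le_sum fun c hc => ?_) ?_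
    · simp only [hf' c (by simpa using hc)]
      exact hks _ fun y => hf _
    · refine le_trans (le_of_eq (Finset.sum_congr rfl fun z _ => ?_))
        (sum_cliqueCut_below_le hh (F := fun c z => f (z * h + c)) (fun _ _ => hf _) N)
      congr 1
      exact Finset.sum_congr rfl fun c hc => hf' c (by simpa using hc) z

/-! ### Sets stable under both compressions -/

theorem cliqueCut_sub {k x : ℕ} (hx : x ≤ k) : cliqueCut k (k - x) = cliqueCut k x := by
  unfold cliqueCut
  rw [Nat.cast_sub hx]; ring

theorem cliqueCut_nonneg {k x : ℕ} (hx : x ≤ k) : 0 ≤ cliqueCut k x := by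
  rcases Nat.eq_zero_or_pos k with rfl | hk
  · have : x = 0 := by omega
    simp [this, cliqueCut]
  · refine mul_nonneg (cliqueCut_coeff_nonneg hk) (mul_nonneg (by positivity) ?_)
    have : (x : ℚ) ≤ k := by exact_mod_cast hx
    linarith

theorem cliqueEnergy_singleton (h : ℕ) (f : ℕ → ℕ) :
    cliqueEnergy [h] f = cliqueCut h (∑ c ∈ range h, f c) := by
  simp [cliqueEnergy]

theorem le_prod_append {mid : List ℕ} (hmid : ∀ k ∈ mid, 1 ≤ k) (h : ℕ) :
    h ≤ (mid ++ [h]).prod := by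
  rw [List.prod_append, List.prod_singleton]
  have : 1 ≤ mid.prod := List.one_le_prod hmid
  nlinarith

/-- The energy of short initial segments and of their complements. -/
theorem exists_cliqueEnergy_append_below {mid : List ℕ} (hmid : ∀ k ∈ mid, 1 ≤ k) (h : ℕ) :
    ∃ D : ℚ, 0 ≤ D ∧ ∀ x ≤ h,
      cliqueEnergy (mid ++ [h]) (below x) = x * D + cliqueCut h x ∧
      cliqueEnergy (mid ++ [h]) (below ((mid ++ [h]).prod - x)) = x * D + cliqueCut h x := by
  induction mid with
  | nil =>
    refine ⟨0, le_rfl, fun x hx => ?_⟩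
    simp only [List.nil_append, cliqueEnergy_singleton, List.prod_singleton]
    rw [sum_below hx, sum_below (Nat.sub_le _ _), cliqueCut_sub hx]
    simp
  | cons k mid ih =>
    obtain ⟨D, hD, ih⟩ := ih fun k hk => hmid k (List.mem_cons_of_mem _ hk)
    have hk : 1 ≤ k := hmid k List.mem_cons_self
    have hN := le_prod_append (fun k hk => hmid k (List.mem_cons_of_mem _ hk)) h
    -- A segment of at most `h` points has at most one point on each line in the direction of `k`,
    -- and its reflected complement misses at most one; each of the x points adds `cliqueCut k 1`.
    refine ⟨D + cliqueCut k 1, add_nonneg hD (cliqueCut_nonneg hk), fun x hx => ?_⟩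
    obtain ⟨h1, h2⟩ := ih x hx
    rw [List.cons_append]
    constructor
    · have := cliqueEnergy_cons_below (k := k) (ks := mid ++ [h]) (q := 0) (r := x) hk
        (hx.trans hN)
      rw [zero_mul, zero_add] at this
      rw [this, h1, cliqueCut_zero]
      ring
    · have := cliqueEnergy_cons_below (k := k) (ks := mid ++ [h]) (q := k - 1)
        (r := (mid ++ [h]).prod - x) (by omega) (Nat.sub_le _ _)
      rw [List.prod_cons]
      have e : (k - 1) * (mid ++ [h]).prod + ((mid ++ [h]).prod - x) =
          k * (mid ++ [h]).prod - x := by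
        obtain ⟨j, rfl⟩ : ∃ j, k = j + 1 := ⟨k - 1, by omega⟩
        have := hx.trans hN
        rw [Nat.add_sub_cancel, Nat.succ_mul]; omega
      rw [e] at this
      rw [this, h2, Nat.sub_add_cancel hk, cliqueCut_self, cliqueCut_sub hk,
        Nat.cast_sub (hx.trans hN)]
      ring

/-- Write p = (a, u, c) and q = (a', u', c'). Stability moves a point of the set down within its
slice a, or down with c fixed. If u were not the last row, (a, P - 1, c') would force p into the
set; if u' were not 0, (a', 0, c) would; if a' > a + 1, the points (a + 1, P - 1, c') and (a + 1, 0,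
c) would, the latter preceding the former because P ≥ 2. -/
theorem eq_of_inversion {k P h : ℕ} (hP : 2 ≤ P) {f : ℕ → ℕ}
    (H1 : ∀ a < k, ∀ v v', v < v' → v' < P * h → f (a * (P * h) + v') = 1 →
      f (a * (P * h) + v) = 1)
    (H2 : ∀ c < h, ∀ z z', z < z' → z' < k * P → f (z' * h + c) = 1 → f (z * h + c) = 1)
    {p q : ℕ} (hpq : p < q) (hq : q < k * (P * h)) (hfp : f p ≠ 1) (hfq : f q = 1) :
    ∃ a c c', a + 1 < k ∧ c' < c ∧ c < h ∧ p + h = (a + 1) * (P * h) + c ∧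
      q = (a + 1) * (P * h) + c' := by
  have hh : 0 < h := by
    rcases Nat.eq_zero_or_pos h with rfl | h0
    · simp at hq
    · exact h0
  have coord : ∀ x < k * (P * h), ∃ a u c, a < k ∧ u < P ∧ c < h ∧ x = (a * P + u) * h + c := by
    intro x hx
    refine ⟨x / h / P, x / h % P, x % h, ?_, Nat.mod_lt _ (by omega), Nat.mod_lt _ hh, ?_⟩
    · rw [Nat.div_div_eq_div_mul, Nat.div_lt_iff_lt_mul (by positivity)]
      rwa [mul_comm h P]
    · rw [Nat.div_add_mod', Nat.div_add_mod']
  have S1 : ∀ a < k, ∀ u c u' c', u' < P → c' < h → u * h + c < u' * h + c' →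
      f ((a * P + u') * h + c') = 1 → f ((a * P + u) * h + c) = 1 := by
    intro a ha u c u' c' hu' hc' hlt h1
    have e : ∀ u c, (a * P + u) * h + c = a * (P * h) + (u * h + c) := fun u c => by ring
    rw [e] at h1 ⊢
    exact H1 a ha _ _ hlt (index_lt hu' hc') h1
  have S2 : ∀ a u a' u' c, a' < k → u < P → u' < P → c < h → (a < a' ∨ a = a' ∧ u < u') →
      f ((a' * P + u') * h + c) = 1 → f ((a * P + u) * h + c) = 1 := by
    intro a u a' u' c ha' hu hu' hc hlt h1
    refine H2 c hc _ _ ?_ (index_lt ha' hu') h1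
    rcases hlt with hlt | ⟨rfl, hlt⟩
    · have := index_lt hlt hu; omega
    · omega
  obtain ⟨a, u, c, ha, hu, hc, rfl⟩ := coord p (hpq.trans hq)
  obtain ⟨a', u', c', ha', hu', hc', rfl⟩ := coord q hq
  have haa : a < a' := by
    by_contra hcon
    rcases Nat.lt_or_ge a' a with hlt | hge
    · have h3 := index_lt hlt hu'
      have h4 : a' * P + u' < a * P + u := by omega
      have := index_lt h4 hc'
      omega
    · have : a = a' := by omega
      subst this
      refine hfp (S1 a ha u c u' c' hu' hc' ?_ hfq)
      have e : ∀ u c, (a * P + u) * h + c = a * (P * h) + (u * h + c) := fun u c => by ring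
      rw [e, e] at hpq
      omega
  have hcne : c ≠ c' := by
    rintro rfl
    exact hfp (S2 a u a' u' c ha' hu hu' hc (Or.inl haa) hfq)
  have htop : f ((a * P + (P - 1)) * h + c') = 1 :=
    S2 a (P - 1) a' u' c' ha' (by omega) hu' hc' (Or.inl haa) hfq
  have hueq : u = P - 1 := by
    by_contra hne
    have h3 : u < P - 1 := by omega
    have := index_lt h3 hc
    exact hfp (S1 a ha u c (P - 1) c' (by omega) hc' (by omega) htop)
  have hcc : c' < c := by
    by_contra hcon
    subst hueq
    exact hfp (S1 a ha (P - 1) c (P - 1) c' hu hc' (by omega) htop)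
  have hueq' : u' = 0 := by
    by_contra hne
    have h3 : 0 < u' := by omega
    have := index_lt h3 hc
    exact hfp (S2 a u a' 0 c ha' hu (by omega) hc (Or.inl haa)
      (S1 a' ha' 0 c u' c' hu' hc' (by omega) hfq))
  have haeq : a' = a + 1 := by
    by_contra hne
    have h3 : f (((a + 1) * P + (P - 1)) * h + c') = 1 :=
      S2 (a + 1) (P - 1) a' u' c' ha' (by omega) hu' hc' (Or.inl (by omega)) hfq
    have h4 := index_lt (show 0 < P - 1 by omega) hc
    exact hfp (S2 a u (a + 1) 0 c (by omega) hu (by omega) hc (Or.inl (by omega))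
      (S1 (a + 1) (by omega) 0 c (P - 1) c' (by omega) hc' (by omega) h3))
  subst haeq hueq hueq'
  refine ⟨a, c, c', ha', hcc, hc, ?_, by ring⟩
  obtain ⟨j, rfl⟩ : ∃ j, P = j + 1 := ⟨P - 1, by omega⟩
  simp only [Nat.add_sub_cancel]
  ring

/-- If the first missing point p precedes the last present point q, `eq_of_inversion` puts them in
the last row of one slice and the first row of the next. Stability inside these two slices then
fixes the set between p and q. -/
theorem eq_below_or_exists_of_stable {k P h : ℕ} (hP : 2 ≤ P) {f : ℕ → ℕ} (hf : ∀ x, f x ≤ 1)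
    (H1 : ∀ a < k, ∀ v v', v < v' → v' < P * h → f (a * (P * h) + v') = 1 →
      f (a * (P * h) + v) = 1)
    (H2 : ∀ c < h, ∀ z z', z < z' → z' < k * P → f (z' * h + c) = 1 → f (z * h + c) = 1) :
    (∃ m ≤ k * (P * h), ∀ x < k * (P * h), f x = below m x) ∨
    ∃ a s t, a + 1 < k ∧ 1 ≤ s ∧ 1 ≤ t ∧ s + t ≤ h ∧ ∀ x < k * (P * h), f x =
      if x + s < (a + 1) * (P * h) ∨ ((a + 1) * (P * h) ≤ x ∧ x < (a + 1) * (P * h) + t)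
      then 1 else 0 := by
  classical
  set n := k * (P * h) with hn
  by_cases hall : ∀ x < n, f x = 1
  · exact Or.inl ⟨n, le_rfl, fun x hx => by simp [below, hall x hx, hx]⟩
  have hex : ∃ x, x < n ∧ f x ≠ 1 := by
    push Not at hall; exact hall
  set p := Nat.find hex with hp
  obtain ⟨hpn, hfp⟩ := Nat.find_spec hex
  have hbelow : ∀ x < p, f x = 1 := by
    intro x hx
    have := Nat.find_min hex hx
    by_contra hcon
    exact this ⟨by omega, hcon⟩
  have zero : ∀ x, f x ≠ 1 → f x = 0 := fun x hx => by have := hf x; omega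
  by_cases hq : ∃ q, p < q ∧ q < n ∧ f q = 1
  · right
    obtain ⟨q₀, hq₀, hq₀n, hfq₀⟩ := hq
    obtain ⟨q, ⟨hpq, hqn, hfq⟩, hmax⟩ : ∃ q, (p < q ∧ q < n ∧ f q = 1) ∧
        ∀ q', q < q' → q' < n → f q' ≠ 1 := by
      -- The last point of the set is n - j for the least admissible j.
      have hex2 : ∃ j, p < n - j ∧ n - j < n ∧ f (n - j) = 1 :=
        ⟨n - q₀, by rw [Nat.sub_sub_self hq₀n.le]; exact ⟨hq₀, hq₀n, hfq₀⟩⟩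
      refine ⟨n - Nat.find hex2, Nat.find_spec hex2, fun q' h1 h2 h3 => ?_⟩
      have h4 : n - q' < Nat.find hex2 := by omega
      refine Nat.find_min hex2 h4 ?_
      rw [Nat.sub_sub_self h2.le]
      have := (Nat.find_spec hex2).1
      exact ⟨by omega, h2, h3⟩
    obtain ⟨a, c, c', ha, hcc, hc, hpe, hqe⟩ := eq_of_inversion hP H1 H2 hpq hqn hfp hfq
    have hsplit : (a + 1) * (P * h) = a * (P * h) + P * h := by ring
    have hPh : h ≤ P * h := by nlinarith
    refine ⟨a, h - c, c' + 1, ha, by omega, by omega, by omega, fun x hx => ?_⟩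
    rcases Nat.lt_or_ge x p with h1 | h1
    · rw [hbelow x h1, if_pos (Or.inl (by omega))]
    rcases Nat.lt_or_ge x ((a + 1) * (P * h)) with h2 | h2
    · rw [if_neg (by omega)]
      refine zero x fun h3 => ?_
      rcases h1.eq_or_lt with h4 | h4
      · exact hfp (by rw [← hp, h4]; exact h3)
      · obtain ⟨v, hv⟩ : ∃ v, p = a * (P * h) + v := ⟨p - a * (P * h), by omega⟩
        obtain ⟨v', hv'⟩ : ∃ v', x = a * (P * h) + v' := ⟨x - a * (P * h), by omega⟩
        refine hfp ?_
        rw [← hp, hv]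
        exact H1 a (by omega) v v' (by omega) (by omega) (hv' ▸ h3)
    · rcases Nat.lt_or_ge x ((a + 1) * (P * h) + (c' + 1)) with h3 | h3
      · rw [if_pos (by omega)]
        obtain ⟨v, hv⟩ : ∃ v, x = (a + 1) * (P * h) + v := ⟨x - (a + 1) * (P * h), by omega⟩
        rcases (show v ≤ c' by omega).eq_or_lt with h4 | h4
        · rw [hv, h4, ← hqe, hfq]
        · rw [hv]
          exact H1 (a + 1) ha v c' h4 (by omega) (hqe ▸ hfq)
      · rw [if_neg (by omega)]
        exact zero x (hmax x (by omega) hx)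
  · left
    refine ⟨p, hpn.le, fun x hx => ?_⟩
    rcases Nat.lt_trichotomy x p with h | h | h
    · simp [below, h, hbelow x h]
    · rw [h, zero p hfp]; simp [below]
    · have : ¬ x < p := by omega
      rw [zero x fun h1 => hq ⟨x, h, hx, h1⟩]; simp [below, this]

theorem cliqueCut_second_difference (k a : ℕ) :
    cliqueCut k (a + 2) + cliqueCut k a - 2 * cliqueCut k (a + 1) =
      -2 * (4 / ((k : ℚ) ^ 2 - 1)) := by
  unfold cliqueCut; push_cast; ring

/-- This pays for the concavity of `cliqueCut k`. The right side is `2 * t * (h - s)` times 4/(h² -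
1), where h - s ≥ 1; since h ≤ k, the weight 4/(h² - 1) is at least 4/(k² - 1). -/
theorem coeff_le_cliqueCut_diff {k h s t : ℕ} (h2 : 2 ≤ h) (hhk : h ≤ k) (ht : t ≤ s)
    (hs : 1 ≤ t) (hst : s + t ≤ h) :
    2 * t * (4 / ((k : ℚ) ^ 2 - 1)) ≤ cliqueCut h s + cliqueCut h t - cliqueCut h (s - t) := by
  have hh : (2 : ℚ) ≤ h := by exact_mod_cast h2
  have hk : (h : ℚ) ≤ k := by exact_mod_cast hhk
  have h1 : 4 / ((k : ℚ) ^ 2 - 1) ≤ 4 / ((h : ℚ) ^ 2 - 1) :=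
    div_le_div_of_nonneg_left (by norm_num) (by nlinarith) (by nlinarith)
  have h0 : (0 : ℚ) ≤ 4 / ((h : ℚ) ^ 2 - 1) := cliqueCut_coeff_nonneg (by omega)
  have e : cliqueCut h s + cliqueCut h t - cliqueCut h (s - t) =
      2 * t * (4 / ((h : ℚ) ^ 2 - 1) * (h - s)) := by
    unfold cliqueCut; rw [Nat.cast_sub ht]; ring
  rw [e]
  refine mul_le_mul_of_nonneg_left (h1.trans ?_) (by positivity)
  have : (1 : ℚ) ≤ h - s := by
    have : (s : ℚ) + 1 ≤ h := by exact_mod_cast (show s + 1 ≤ h by omega)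
    linarith
  nlinarith

/-- The energy of an initial segment with `s` vertices removed from the end of a slice and `t`
vertices added to the beginning of the next one. -/
theorem cliqueEnergy_of_split {k : ℕ} {ks : List ℕ} {f : ℕ → ℕ} {a s t : ℕ} (ha : a + 1 < k)
    (hst : s + t ≤ ks.prod) (hf : ∀ x < k * ks.prod, f x =
      if x + s < (a + 1) * ks.prod ∨ ((a + 1) * ks.prod ≤ x ∧ x < (a + 1) * ks.prod + t)
      then 1 else 0) :
    cliqueEnergy (k :: ks) f = cliqueEnergy ks (below (ks.prod - s)) + cliqueEnergy ks (below t) +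
      (t * cliqueCut k (a + 2) + (ks.prod - s - t) * cliqueCut k (a + 1) + s * cliqueCut k a) ∧
    ∑ x ∈ range (k * ks.prod), f x = (a + 1) * ks.prod - s + t := by
  set N := ks.prod with hN
  let m : ℕ → ℕ := fun b => if b < a then N else if b = a then N - s else if b = a + 1 then t else 0
  have hsl : ∀ b < k, ∀ y < N, f (b * N + y) = below (m b) y := by
    intro b hb y hy
    rw [hf _ (index_lt hb hy)]
    have e1 : (a + 1) * N = a * N + N := by ring
    have key : (b * N + y + s < (a + 1) * N ∨
        ((a + 1) * N ≤ b * N + y ∧ b * N + y < (a + 1) * N + t)) ↔ y < m b := by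
      simp only [m]
      split_ifs with h1 h2 h3
      · have h4 := index_lt h1 hy
        have h5 : (b + 1) * N ≤ a * N := Nat.mul_le_mul_right _ h1
        rw [Nat.succ_mul] at h5
        omega
      · subst h2; omega
      · subst h3; omega
      · have h4 : (a + 2) * N ≤ b * N := Nat.mul_le_mul_right _ (by omega)
        have e2 : (a + 2) * N = a * N + N + N := by ring
        omega
    simp only [key, below]
  obtain ⟨e, rfl⟩ : ∃ e, k = a + (2 + e) := ⟨k - a - 2, by omega⟩
  have hsum : ∀ g : ℕ → ℚ, g N = 0 → g 0 = 0 →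
      ∑ b ∈ range (a + (2 + e)), g (m b) = g (N - s) + g t := by
    intro g h1 h2
    rw [Finset.sum_range_add, Finset.sum_range_add]
    have e1 : ∑ x ∈ range a, g (m x) = 0 := Finset.sum_eq_zero fun x hx => by
      have : x < a := by simpa using hx
      simp [m, this, h1]
    have e2 : ∑ x ∈ range e, g (m (a + (2 + x))) = 0 := Finset.sum_eq_zero fun x hx => by
      have h4 : ¬ (2 + x = 1) := by omega
      simp [m, h4, h2]
    rw [e1, e2]
    simp [m, Finset.sum_range_succ]
  have hsumn : ∀ g : ℕ → ℕ, g 0 = 0 →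
      ∑ b ∈ range (a + (2 + e)), g (m b) = a * g N + g (N - s) + g t := by
    intro g h2
    rw [Finset.sum_range_add, Finset.sum_range_add]
    have e1 : ∑ x ∈ range a, g (m x) = a * g N := by
      rw [Finset.sum_congr rfl (g := fun _ => g N)]
      · simp
      · intro x hx
        have : x < a := by simpa using hx
        simp [m, this]
    have e2 : ∑ x ∈ range e, g (m (a + (2 + x))) = 0 := Finset.sum_eq_zero fun x hx => by
      have h4 : ¬ (2 + x = 1) := by omega
      simp [m, h4, h2]
    rw [e1, e2]
    simp [m, Finset.sum_range_succ, add_assoc]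
  have hmN : ∀ b, m b ≤ N := by
    intro b; simp only [m]; split_ifs <;> omega
  constructor
  · rw [cliqueEnergy_cons_of_slices m hsl, hsum (fun x => cliqueEnergy ks (below x)) (cliqueEnergy_below_prod ks)
      (cliqueEnergy_below_zero ks)]
    congr 1
    have hc : ∀ y ∈ range N, ∑ b ∈ range (a + (2 + e)), below (m b) y =
        a + below (N - s) y + below t y := by
      intro y hy
      have hy : y < N := by simpa using hy
      rw [hsumn (fun m => below m y) (by simp [below])]
      simp [below, hy]
    rw [← hN, Finset.sum_congr rfl fun y hy => by rw [hc y hy]]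
    obtain ⟨j, hj⟩ : ∃ j, N = t + (j + s) := ⟨N - t - s, by omega⟩
    rw [hj, Finset.sum_range_add, Finset.sum_range_add]
    have e1 : ∀ x ∈ range t, cliqueCut (a + (2 + e)) (a + below (t + (j + s) - s) x + below t x) =
        cliqueCut (a + (2 + e)) (a + 2) := by
      intro x hx
      have h1 : x < t := by simpa using hx
      have h2 : x < t + (j + s) - s := by omega
      simp [below, h1, h2]
    have e2 : ∀ x ∈ range j, cliqueCut (a + (2 + e))
        (a + below (t + (j + s) - s) (t + x) + below t (t + x)) =
        cliqueCut (a + (2 + e)) (a + 1) := by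
      intro x hx
      have h1 : x < j := by simpa using hx
      have h2 : t + x < t + (j + s) - s := by omega
      simp [below, h2]
    have e3 : ∀ x ∈ range s, cliqueCut (a + (2 + e))
        (a + below (t + (j + s) - s) (t + (j + x)) + below t (t + (j + x))) =
        cliqueCut (a + (2 + e)) a := by
      intro x hx
      have h1 : ¬ (t + (j + x) < t + (j + s) - s) := by omega
      simp [below, h1]
    rw [Finset.sum_congr rfl e1, Finset.sum_congr rfl e2, Finset.sum_congr rfl e3]
    simp only [sum_const, card_range, nsmul_eq_mul]
    push_cast
    ring
  · rw [sum_range_mul_eq, Finset.sum_congr rfl fun b hb => by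
      rw [Finset.sum_congr rfl fun y hy => hsl b (by simpa using hb) y (by simpa using hy),
        sum_below (hmN b)]]
    rw [hsumn (fun m => m) rfl, Nat.succ_mul]
    omega

/-- Isoperimetry in at least three dimensions follows from isoperimetry in lower dimensions. -/
theorem belowOptimal_of_compression {k h : ℕ} {mid : List ℕ} (h2 : 2 ≤ h) (hhk : h ≤ k)
    (hmid : ∀ j ∈ mid, 1 ≤ j) (hP : 2 ≤ mid.prod) (hright : BelowOptimal (mid ++ [h]))
    (hleft : BelowOptimal (k :: mid)) : BelowOptimal (k :: (mid ++ [h])) := by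
  have hprod : (mid ++ [h]).prod = mid.prod * h := by simp
  -- The sum of positions is exposed for strong induction: an unstable set can be compressed, which
  -- lowers it.
  suffices H : ∀ r (f : ℕ → ℕ), (∀ x, f x ≤ 1) →
      ∑ x ∈ range (k * (mid ++ [h]).prod), x * f x = r →
      cliqueEnergy (k :: (mid ++ [h])) (below (∑ x ∈ range (k * (mid ++ [h]).prod), f x)) ≤
        cliqueEnergy (k :: (mid ++ [h])) f by
    intro f hf
    rw [List.prod_cons]
    exact H _ f hf rfl
  intro r
  induction r using Nat.strong_induction_on with
  | _ r ih =>
  intro f hf hr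
  have zero : ∀ x, f x ≠ 1 → f x = 0 := fun x hx => by have := hf x; omega
  by_cases hc1 : ∀ a < k, ∀ v v', v < v' → v' < mid.prod * h →
      f (a * (mid.prod * h) + v') = 1 → f (a * (mid.prod * h) + v) = 1
  swap
  · push Not at hc1
    obtain ⟨a, ha, v, v', hvv, hv, h1, h0⟩ := hc1
    rw [← hprod] at hv h1 h0
    obtain ⟨f', hf', hs, hrank, hE⟩ :=
      exists_compression_cons (by omega) hright hf ha hvv hv (zero _ h0) h1
    rw [← hs]
    exact (ih _ (hr ▸ hrank) f' hf' rfl).trans hE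
  by_cases hc2 : ∀ c < h, ∀ z z', z < z' → z' < k * mid.prod →
      f (z' * h + c) = 1 → f (z * h + c) = 1
  swap
  · push Not at hc2
    obtain ⟨c, hc, z, z', hzz, hz, h1, h0⟩ := hc2
    rw [← List.prod_cons] at hz
    obtain ⟨f', hf', hs, hrank, hE⟩ :=
      exists_compression_append (by omega) hleft hf hc hzz hz (zero _ h0) h1
    have e : (k :: mid).prod * h = k * (mid ++ [h]).prod := by
      rw [hprod, List.prod_cons, mul_assoc]
    rw [e] at hs hrank
    rw [← hs]
    exact (ih _ (hr ▸ hrank) f' hf' rfl).trans hE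
  rcases eq_below_or_exists_of_stable hP hf hc1 hc2 with ⟨m, hm, hfm⟩ | ⟨a, s, t, ha, hs, ht, hst, hfs⟩
  · rw [← hprod] at hm hfm
    have hsum : ∑ x ∈ range (k * (mid ++ [h]).prod), f x = m := by
      rw [← sum_below hm]
      exact Finset.sum_congr rfl fun x hx => hfm x (by simpa using hx)
    rw [hsum]
    refine le_of_eq (cliqueEnergy_congr fun x hx => (hfm x ?_).symm)
    rwa [List.prod_cons] at hx
  · rw [← hprod] at hfs
    have hN := le_prod_append hmid h
    obtain ⟨hE, hsum⟩ := cliqueEnergy_of_split ha (hst.trans hN) hfs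
    obtain ⟨D, hD, hlow⟩ := exists_cliqueEnergy_append_below hmid h
    rw [hE, hsum, (hlow s (by omega)).2, (hlow t (by omega)).1]
    set N := (mid ++ [h]).prod with hNdef
    have hdd := cliqueCut_second_difference k a
    -- The competing initial segment ends s - t points before the border of the slices, or t - s
    -- points after it. With τ = min s t, the split set exceeds it by 2τD, plus the right side of
    -- `coeff_le_cliqueCut_diff` (s and t swapped if s ≤ t), minus 2τ · 4/(k² - 1).
    rcases Nat.le_total t s with hts | hts
    · have e : (a + 1) * N - s + t = a * N + (N - (s - t)) := by rw [Nat.succ_mul]; omega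
      rw [e, cliqueEnergy_cons_below (by omega) (Nat.sub_le _ _), (hlow (s - t) (by omega)).2,
        Nat.cast_sub (show s - t ≤ N by omega), Nat.cast_sub hts]
      have h5 := coeff_le_cliqueCut_diff h2 hhk hts ht hst
      have h6 : (0 : ℚ) ≤ t * D := by positivity
      rw [← hNdef]
      linear_combination h5 + 2 * h6 - (t : ℚ) * hdd
    · have e : (a + 1) * N - s + t = (a + 1) * N + (t - s) := by rw [Nat.succ_mul]; omega
      rw [e, cliqueEnergy_cons_below ha (by omega), (hlow (t - s) (by omega)).1,
        Nat.cast_sub hts]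
      have h5 := coeff_le_cliqueCut_diff h2 hhk hts hs (by omega)
      have h6 : (0 : ℚ) ≤ s * D := by positivity
      rw [← hNdef]
      linear_combination h5 + 2 * h6 - (s : ℚ) * hdd

/-! ### An isoperimetric inequality in ℤ/h -/

theorem exists_shrink {ι : Type*} [DecidableEq ι] (T : Finset ι) (x : ι → ℕ)
    (hx : ∀ t ∈ T, 1 ≤ x t) (ρ : ℕ) (h1 : #T ≤ ρ) (h2 : ρ ≤ ∑ t ∈ T, x t) :
    ∃ x' : ι → ℕ, (∀ t ∈ T, 1 ≤ x' t ∧ x' t ≤ x t) ∧ ∑ t ∈ T, x' t = ρ := by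
  induction T using Finset.induction_on generalizing ρ with
  | empty => exact ⟨x, by simp, by simp at h2; simp [h2]⟩
  | insert a T ha ih =>
    rw [Finset.card_insert_of_notMem ha] at h1
    rw [Finset.sum_insert ha] at h2
    have hxa := hx a (Finset.mem_insert_self _ _)
    have hxT : ∀ t ∈ T, 1 ≤ x t := fun t ht => hx t (Finset.mem_insert_of_mem ht)
    have hne : ∀ t ∈ T, t ≠ a := fun t ht h => ha (h ▸ ht)
    have ext : ∀ (x' : ι → ℕ) (v : ℕ), 1 ≤ v → v ≤ x a →
        (∀ t ∈ T, 1 ≤ x' t ∧ x' t ≤ x t) → v + ∑ t ∈ T, x' t = ρ →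
        ∃ x' : ι → ℕ, (∀ t ∈ insert a T, 1 ≤ x' t ∧ x' t ≤ x t) ∧
          ∑ t ∈ insert a T, x' t = ρ := by
      intro x' v hv1 hv2 hb hs
      refine ⟨Function.update x' a v, fun t ht => ?_, ?_⟩
      · rcases Finset.mem_insert.1 ht with rfl | ht
        · simp [hv1, hv2]
        · simpa [Function.update_of_ne (hne t ht)] using hb t ht
      · rw [Finset.sum_insert ha, Function.update_self, ← hs]
        congr 1
        exact Finset.sum_congr rfl fun t ht => Function.update_of_ne (hne t ht) _ _
    by_cases hc : ρ - 1 ≤ ∑ t ∈ T, x t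
    · obtain ⟨x', hb, hs⟩ := ih hxT (ρ - 1) (by omega) hc
      exact ext x' 1 le_rfl hxa hb (by omega)
    · exact ext x (ρ - ∑ t ∈ T, x t) (by omega) (by omega) (fun t ht => ⟨hxT t ht, le_rfl⟩)
        (by omega)

/-- The number of edges of the complete graph on `h` vertices between a set of `v` vertices and its
complement, as a function of the residue class of `v`. -/
def cyclicCut (h : ℕ) (v : ZMod h) : ℤ := v.valMinAbs.natAbs * (h - v.valMinAbs.natAbs)

theorem two_mul_natAbs_valMinAbs_le {h : ℕ} [NeZero h] (v : ZMod h) : 2 * v.valMinAbs.natAbs ≤ h := by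
  have := ZMod.natAbs_valMinAbs_le v
  omega

theorem cyclicCut_nonneg {h : ℕ} [NeZero h] (v : ZMod h) : 0 ≤ cyclicCut h v := by
  have := two_mul_natAbs_valMinAbs_le v
  unfold cyclicCut
  apply mul_nonneg <;> omega

theorem cyclicCut_neg {h : ℕ} (v : ZMod h) : cyclicCut h (-v) = cyclicCut h v := by
  unfold cyclicCut; rw [ZMod.natAbs_valMinAbs_neg]

theorem cyclicCut_natCast {h : ℕ} [NeZero h] {x : ℕ} (hx : x ≤ h) : cyclicCut h (x : ZMod h) = x * (h - x) := by
  unfold cyclicCut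
  rw [ZMod.valMinAbs_natAbs_eq_min]
  rcases hx.eq_or_lt with rfl | hlt
  · simp
  · rw [ZMod.val_natCast_of_lt hlt]
    rcases le_total x (h - x) with h1 | h1
    · rw [min_eq_left h1]
    · rw [min_eq_right h1, Nat.cast_sub hx]; ring

theorem four_mul_cyclicCut_le {h : ℕ} (v : ZMod h) : 4 * cyclicCut h v ≤ (h : ℤ) ^ 2 := by
  unfold cyclicCut
  nlinarith [sq_nonneg ((h : ℤ) - 2 * v.valMinAbs.natAbs)]

theorem mul_sub_mono {x y h : ℤ} (hxy : x ≤ y) (hy : 2 * y ≤ h) : x * (h - x) ≤ y * (h - y) := by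
  nlinarith

theorem le_cyclicCut {h : ℕ} [NeZero h] {v : ZMod h} (hv : v ≠ 0) : (h : ℤ) - 1 ≤ cyclicCut h v := by
  have h1 : 1 ≤ v.valMinAbs.natAbs := by
    rcases Nat.eq_zero_or_pos v.valMinAbs.natAbs with h0 | h0
    · exact absurd (by simpa using h0) hv
    · exact h0
  have := mul_sub_mono (x := 1) (y := v.valMinAbs.natAbs) (h := h) (by omega)
    (by have := two_mul_natAbs_valMinAbs_le v; omega)
  unfold cyclicCut; linarith

theorem natAbs_valMinAbs_sum_le {h : ℕ} {ι : Type*} (T : Finset ι) (c : ι → ZMod h) :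
    (∑ t ∈ T, c t).valMinAbs.natAbs ≤ ∑ t ∈ T, (c t).valMinAbs.natAbs := by
  classical
  induction T using Finset.induction_on with
  | empty => simp
  | insert a T ha ih =>
    rw [Finset.sum_insert ha, Finset.sum_insert ha]
    exact (ZMod.natAbs_valMinAbs_add_le _ _).trans
      ((Int.natAbs_add_le _ _).trans (Nat.add_le_add_left ih _))

/-- Put n = #T and S = ∑ x(h - x). As every x is at least 1, S ≤ ρ(h - 1) and ∑ x(ρ - x) ≥ ρ(n - 1).
Hence (n - 1)S ≤ (h - 1)∑ x(ρ - x), and ∑ x(ρ - x) = S - ρ(h - ρ). -/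
theorem sum_mul_sub_bound {ι : Type*} (T : Finset ι) (x : ι → ℕ) (hx : ∀ t ∈ T, 1 ≤ x t)
    (hT : 1 ≤ #T) {h ρ : ℕ} (hs : ∑ t ∈ T, x t = ρ) (hh : 1 ≤ h) :
    ((h : ℤ) - 1) * (ρ * (h - ρ)) ≤ (h - #T) * ∑ t ∈ T, (x t : ℤ) * (h - x t) := by
  have hsz : ∑ t ∈ T, (x t : ℤ) = ρ := by exact_mod_cast hs
  have e1 : ∑ t ∈ T, (x t : ℤ) * (h - x t) = h * ρ - ∑ t ∈ T, (x t : ℤ) ^ 2 := by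
    rw [← hsz, Finset.mul_sum, ← Finset.sum_sub_distrib]
    exact Finset.sum_congr rfl fun t _ => by ring
  have e2 : ∑ t ∈ T, (x t : ℤ) * (ρ - x t) = ρ * ρ - ∑ t ∈ T, (x t : ℤ) ^ 2 := by
    nth_rewrite 2 [← hsz]
    rw [Finset.sum_mul, ← Finset.sum_sub_distrib]
    exact Finset.sum_congr rfl fun t _ => by ring
  have b1 : ∑ t ∈ T, (x t : ℤ) * (h - x t) ≤ ρ * (h - 1) := by
    rw [← hsz, Finset.sum_mul]
    refine Finset.sum_le_sum fun t ht => ?_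
    have : (1 : ℤ) ≤ x t := by exact_mod_cast hx t ht
    nlinarith
  have b2 : (ρ : ℤ) * (#T - 1) ≤ ∑ t ∈ T, (x t : ℤ) * (ρ - x t) := by
    classical
    rw [← hsz, Finset.sum_mul, hsz]
    refine Finset.sum_le_sum fun t ht => ?_
    have h1 : ∑ s ∈ T.erase t, x s + x t = ρ := by rw [← hs]; exact Finset.sum_erase_add _ _ ht
    have h2 : #(T.erase t) ≤ ∑ s ∈ T.erase t, x s := by
      rw [Finset.card_eq_sum_ones]
      exact Finset.sum_le_sum fun s hs => hx s (Finset.mem_of_mem_erase hs)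
    rw [Finset.card_erase_of_mem ht] at h2
    have h3 : (#T : ℤ) - 1 ≤ ρ - x t := by omega
    exact mul_le_mul_of_nonneg_left h3 (by positivity)
  have hT' : (1 : ℤ) ≤ #T := by exact_mod_cast hT
  have hh' : (1 : ℤ) ≤ h := by exact_mod_cast hh
  have b3 : ((#T : ℤ) - 1) * ∑ t ∈ T, (x t : ℤ) * (h - x t) ≤
      (h - 1) * ∑ t ∈ T, (x t : ℤ) * (ρ - x t) := by
    calc ((#T : ℤ) - 1) * ∑ t ∈ T, (x t : ℤ) * (h - x t) ≤ (#T - 1) * (ρ * (h - 1)) :=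
          mul_le_mul_of_nonneg_left b1 (by linarith)
      _ = (h - 1) * (ρ * (#T - 1)) := by ring
      _ ≤ _ := mul_le_mul_of_nonneg_left b2 (by linarith)
  rw [e2] at b3
  have e3 : (ρ : ℤ) * ρ - ∑ t ∈ T, (x t : ℤ) ^ 2 =
      ∑ t ∈ T, (x t : ℤ) * (h - x t) - (h * ρ - ρ * ρ) := by rw [e1]; ring
  rw [e3] at b3
  linear_combination b3

/-- Let v be a most frequent value, A the indices where it occurs, B the others, and ρ the distance
of the sum from 0. Because there are h terms, subtracting v from all of them preserves the sum. If
#B < ρ, the distances of the terms in B from v add up to at least ρ; shrunk to total exactly ρ, they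
give the bound from the pairs between A and B alone. If #B ≥ ρ, it is enough that each unequal pair
contributes at least h - 1. -/
theorem cyclic_isoperimetry {h : ℕ} [NeZero h] {ι : Type*} [DecidableEq ι] (I : Finset ι) (hI : #I = h)
    (c : ι → ZMod h) :
    2 * ((h : ℤ) - 1) * cyclicCut h (∑ t ∈ I, c t) ≤
      ∑ s ∈ I, ∑ t ∈ I, cyclicCut h (c s - c t) := by
  have hh : 1 ≤ h := NeZero.one_le
  have hh' : (1 : ℤ) ≤ h := by exact_mod_cast hh
  obtain ⟨v, -, hv⟩ := Finset.exists_max_image (Finset.univ : Finset (ZMod h))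
    (fun v => #{t ∈ I | c t = v}) Finset.univ_nonempty
  set A := {t ∈ I | c t = v} with hA
  set B := {t ∈ I | ¬ c t = v} with hB
  have hAB : #A + #B = h := by rw [← hI]; exact Finset.card_filter_add_card_filter_not _
  have split : ∀ F : ι → ℤ, ∑ t ∈ I, F t = ∑ t ∈ A, F t + ∑ t ∈ B, F t := fun F =>
    (Finset.sum_filter_add_sum_filter_not I _ F).symm
  set ρ := (∑ t ∈ I, c t).valMinAbs.natAbs with hρ
  have hρ2 : 2 * ρ ≤ h := two_mul_natAbs_valMinAbs_le _
  have hcut : cyclicCut h (∑ t ∈ I, c t) = ρ * (h - ρ) := rfl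
  rw [hcut]
  rcases Nat.lt_or_ge #B ρ with hu | hu
  · have hBne : 1 ≤ #B := by
      by_contra hcon
      have hB0 : #B = 0 := by omega
      have hall : ∀ t ∈ I, c t = v := by
        intro t ht
        by_contra hne
        have : t ∈ B := by simp [hB, ht, hne]
        rw [Finset.card_eq_zero.1 hB0] at this
        simp at this
      have : ∑ t ∈ I, c t = 0 := by
        rw [Finset.sum_congr rfl hall, Finset.sum_const, hI, nsmul_eq_mul, ZMod.natCast_self,
          zero_mul]
      rw [hρ, this] at hu
      simp at hu
    have hsum : ∑ t ∈ I, c t = ∑ t ∈ B, (c t - v) := by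
      have h1 : ∑ t ∈ I, c t = ∑ t ∈ I, (c t - v) := by
        rw [Finset.sum_sub_distrib, Finset.sum_const, hI, nsmul_eq_mul, ZMod.natCast_self,
          zero_mul, sub_zero]
      rw [h1, ← Finset.sum_filter_add_sum_filter_not I (fun t => c t = v)]
      rw [Finset.sum_eq_zero, zero_add]
      intro t ht
      rw [(Finset.mem_filter.1 ht).2, sub_self]
    have hρle : ρ ≤ ∑ t ∈ B, (c t - v).valMinAbs.natAbs := by
      rw [hρ, hsum]; exact natAbs_valMinAbs_sum_le _ _
    obtain ⟨x, hx, hxs⟩ := exists_shrink B (fun t => (c t - v).valMinAbs.natAbs) (fun t ht => by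
      have h1 : c t - v ≠ 0 := sub_ne_zero.2 (Finset.mem_filter.1 ht).2
      rcases Nat.eq_zero_or_pos (c t - v).valMinAbs.natAbs with h0 | h0
      · exact absurd (by simpa using h0) h1
      · exact h0) ρ hu.le hρle
    have b1 := sum_mul_sub_bound B x (fun t ht => (hx t ht).1) hBne hxs hh
    have b2 : ∑ t ∈ B, (x t : ℤ) * (h - x t) ≤ ∑ t ∈ B, cyclicCut h (c t - v) := by
      refine Finset.sum_le_sum fun t ht => mul_sub_mono (by exact_mod_cast (hx t ht).2) ?_
      have := two_mul_natAbs_valMinAbs_le (c t - v)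
      exact_mod_cast this
    have e1 : ∑ s ∈ A, ∑ t ∈ B, cyclicCut h (c s - c t) =
        #A * ∑ t ∈ B, cyclicCut h (c t - v) := by
      rw [Finset.sum_congr rfl (g := fun _ => ∑ t ∈ B, cyclicCut h (c t - v))]
      · simp
      · intro s hs
        refine Finset.sum_congr rfl fun t _ => ?_
        rw [(Finset.mem_filter.1 hs).2, ← cyclicCut_neg, neg_sub]
    have e2 : ∑ s ∈ B, ∑ t ∈ A, cyclicCut h (c s - c t) =
        #A * ∑ t ∈ B, cyclicCut h (c t - v) := by
      rw [Finset.mul_sum]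
      refine Finset.sum_congr rfl fun s _ => ?_
      rw [Finset.sum_congr rfl (g := fun _ => cyclicCut h (c s - v))]
      · simp
      · intro t ht
        rw [(Finset.mem_filter.1 ht).2]
    have n1 : 0 ≤ ∑ s ∈ A, ∑ t ∈ A, cyclicCut h (c s - c t) :=
      Finset.sum_nonneg fun _ _ => Finset.sum_nonneg fun _ _ => cyclicCut_nonneg _
    have n2 : 0 ≤ ∑ s ∈ B, ∑ t ∈ B, cyclicCut h (c s - c t) :=
      Finset.sum_nonneg fun _ _ => Finset.sum_nonneg fun _ _ => cyclicCut_nonneg _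
    have e3 : ∑ s ∈ I, ∑ t ∈ I, cyclicCut h (c s - c t) =
        (∑ s ∈ A, ∑ t ∈ A, cyclicCut h (c s - c t) + ∑ s ∈ A, ∑ t ∈ B, cyclicCut h (c s - c t)) +
        (∑ s ∈ B, ∑ t ∈ A, cyclicCut h (c s - c t) +
          ∑ s ∈ B, ∑ t ∈ B, cyclicCut h (c s - c t)) := by
      rw [split, ← Finset.sum_add_distrib, ← Finset.sum_add_distrib]
      congr 1 <;> exact Finset.sum_congr rfl fun s _ => split _
    have hAz : (#A : ℤ) = h - #B := by omega
    rw [e3, e1, e2]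
    rw [← hAz] at b1
    have b3 : (#A : ℤ) * ∑ t ∈ B, (x t : ℤ) * (h - x t) ≤
        #A * ∑ t ∈ B, cyclicCut h (c t - v) := mul_le_mul_of_nonneg_left b2 (by positivity)
    linarith
  · have row : ∀ s, ∀ j : ℕ, j + #{t ∈ I | c t = c s} ≤ h →
        ((h : ℤ) - 1) * j ≤ ∑ t ∈ I, cyclicCut h (c s - c t) := by
      intro s j hj
      have h1 : #{t ∈ I | c t = c s} + #{t ∈ I | ¬ c t = c s} = h :=
        (Finset.card_filter_add_card_filter_not _).trans hI
      calc ((h : ℤ) - 1) * j ≤ ((h : ℤ) - 1) * #{t ∈ I | ¬ c t = c s} :=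
            mul_le_mul_of_nonneg_left (by omega) (by linarith)
        _ = ∑ t ∈ I with ¬ c t = c s, ((h : ℤ) - 1) := by rw [Finset.sum_const, nsmul_eq_mul, mul_comm]
        _ ≤ ∑ t ∈ I with ¬ c t = c s, cyclicCut h (c s - c t) := by
            refine Finset.sum_le_sum fun t ht => le_cyclicCut ?_
            exact sub_ne_zero.2 fun h => (Finset.mem_filter.1 ht).2 h.symm
        _ ≤ _ := Finset.sum_le_sum_of_subset_of_nonneg (Finset.filter_subset _ _)
            fun _ _ _ => cyclicCut_nonneg _
    have rA : ((h : ℤ) - 1) * #B * #A ≤ ∑ s ∈ A, ∑ t ∈ I, cyclicCut h (c s - c t) := by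
      have : ∑ s ∈ A, ((h : ℤ) - 1) * #B = ((h : ℤ) - 1) * #B * #A := by simp [mul_comm]
      rw [← this]
      refine Finset.sum_le_sum fun s hs => row s _ ?_
      rw [(Finset.mem_filter.1 hs).2]
      change #B + #A ≤ h
      omega
    -- The value at an index of B occurs at most #A times by the choice of v, and at most #B times
    -- because all its occurrences lie in B.
    have rB : ∀ j : ℕ, j ≤ max #A #B → ((h : ℤ) - 1) * j * #B ≤
        ∑ s ∈ B, ∑ t ∈ I, cyclicCut h (c s - c t) := by
      intro j hj
      have : ∑ s ∈ B, ((h : ℤ) - 1) * j = ((h : ℤ) - 1) * j * #B := by simp [mul_comm]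
      rw [← this]
      refine Finset.sum_le_sum fun s hs => row s _ ?_
      have h1 : #{t ∈ I | c t = c s} ≤ #A := hv (c s) (Finset.mem_univ _)
      have h2 : #{t ∈ I | c t = c s} ≤ #B := by
        refine Finset.card_le_card fun t ht => ?_
        obtain ⟨ht1, ht2⟩ := Finset.mem_filter.1 ht
        refine Finset.mem_filter.2 ⟨ht1, ?_⟩
        rw [ht2]; exact (Finset.mem_filter.1 hs).2
      omega
    rw [split]
    have hAz : (#A : ℤ) = h - #B := by omega
    have hm : (0 : ℤ) ≤ h - 1 := by linarith
    rcases Nat.le_total #B #A with hc | hc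
    · have h1 := rB #A (le_max_left _ _)
      have h2 := mul_sub_mono (x := ρ) (y := #B) (h := h) (by omega) (by omega)
      rw [← hAz] at h2
      have h3 := mul_le_mul_of_nonneg_left h2 hm
      linarith
    · have h1 := rB #B (le_max_right _ _)
      have h2 : 2 * ((ρ : ℤ) * (h - ρ)) ≤ #B * (#A + #B) := by
        have h3 : (h : ℤ) ≤ 2 * #B := by omega
        have h4 : (#A : ℤ) + #B = h := by omega
        rw [h4]
        nlinarith [sq_nonneg ((h : ℤ) - 2 * ρ)]
      have h3 := mul_le_mul_of_nonneg_left h2 hm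
      linarith

/-! ### Isoperimetry with two factors -/

/-- For k = h = K the sides agree. Otherwise K ≥ 2k. If x ≤ h, the sides differ by x(K - h)(x - 1);
if x ≥ h, the cyclic cut is at most h²/4 while x(K - x) ≥ h(K - h). -/
theorem cyclicCut_le_of_le {k h : ℕ} [NeZero h] (hh : 2 ≤ h) {K : ℚ}
    (hK : (k = h ∧ K = h) ∨ (2 * h + 1 ≤ k ∧ (k : ℚ) ^ 2 ≤ K * h)) {x : ℕ} (hx : x ≤ k) :
    (K - 1) * cyclicCut h (x : ZMod h) ≤ (h - 1) * (x * (K - x)) := by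
  have hhq : (2 : ℚ) ≤ h := by exact_mod_cast hh
  rcases hK with ⟨rfl, rfl⟩ | ⟨hkh, hK⟩
  · rw [cyclicCut_natCast hx]; push_cast; linarith
  have hkq : 2 * (h : ℚ) + 1 ≤ k := by exact_mod_cast hkh
  have hKk : 2 * (k : ℚ) ≤ K := by
    by_contra hcon
    push Not at hcon
    nlinarith
  rcases Nat.le_total x h with hxh | hxh
  · rw [cyclicCut_natCast hxh]
    push_cast
    rcases Nat.eq_zero_or_pos x with rfl | hx0
    · simp
    · have h1 : (1 : ℚ) ≤ x := by exact_mod_cast hx0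
      have h2 : 0 ≤ (x : ℚ) * ((K - h) * (x - 1)) :=
        mul_nonneg (by linarith) (mul_nonneg (by linarith) (by linarith))
      linear_combination h2
  · have h1 : 4 * (cyclicCut h (x : ZMod h) : ℚ) ≤ (h : ℚ) ^ 2 := by
      exact_mod_cast four_mul_cyclicCut_le (x : ZMod h)
    have hxq : (x : ℚ) ≤ k := by exact_mod_cast hx
    have hxq' : (h : ℚ) ≤ x := by exact_mod_cast hxh
    have h2 : h * (K - h) ≤ x * (K - x) := by
      have a1 := mul_nonneg (sub_nonneg.2 hxq') (sub_nonneg.2 hxq)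
      have a2 : 0 ≤ ((x : ℚ) - h) * (K - h - k) := mul_nonneg (by linarith) (by linarith)
      linear_combination a1 + a2
    have h3 : (K - 1) * (h : ℚ) ^ 2 ≤ 4 * ((h - 1) * (h * (K - h))) := by
      have a1 : (K - 1) * h ≤ 4 * ((h - 1) * (K - h)) := by nlinarith
      have := mul_le_mul_of_nonneg_left a1 (show (0 : ℚ) ≤ h by linarith)
      linear_combination this
    have h4 := mul_le_mul_of_nonneg_left h1 (show 0 ≤ K - 1 by linarith)
    have h5 := mul_le_mul_of_nonneg_left h2 (show (0 : ℚ) ≤ h - 1 by linarith)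
    linarith

/-- Equality holds when r of the values are q + 1 and the others q. In general, each summand times h
- 1 is at least K - 1 times the cyclic cut of the difference modulo h, and the sum of all values is
r modulo h. -/
theorem sum_diff_bound {k h : ℕ} (hh : 2 ≤ h) {K : ℚ}
    (hK : (k = h ∧ K = h) ∨ (2 * h + 1 ≤ k ∧ (k : ℚ) ^ 2 ≤ K * h)) {c : ℕ → ℕ}
    (hc : ∀ t, c t ≤ k) {q r : ℕ} (hr : r ≤ h) (hs : ∑ t ∈ range h, c t = q * h + r) :
    2 * (K - 1) * (r * (h - r)) ≤
      ∑ s ∈ range h, ∑ t ∈ range h, (K * |(c s : ℚ) - c t| - ((c s : ℚ) - c t) ^ 2) := by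
  have : NeZero h := ⟨by omega⟩
  have hhq : (2 : ℚ) ≤ h := by exact_mod_cast hh
  have hK1 : 0 ≤ K - 1 := by
    rcases hK with ⟨_, rfl⟩ | ⟨hkh, hK⟩
    · linarith
    · have hkq : 2 * (h : ℚ) + 1 ≤ k := by exact_mod_cast hkh
      by_contra hcon
      push Not at hcon
      nlinarith
  have h1 := cyclic_isoperimetry (range h) (card_range h) (fun t => (c t : ZMod h))
  rw [← Nat.cast_sum, hs, Nat.cast_add, Nat.cast_mul, ZMod.natCast_self, mul_zero, zero_add,
    cyclicCut_natCast hr] at h1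
  have h1q : 2 * ((h : ℚ) - 1) * (r * (h - r)) ≤
      ∑ s ∈ range h, ∑ t ∈ range h, (cyclicCut h ((c s : ZMod h) - c t) : ℚ) := by
    exact_mod_cast h1
  have hpt : ∀ s t, (K - 1) * (cyclicCut h ((c s : ZMod h) - c t) : ℚ) ≤
      (h - 1) * (K * |(c s : ℚ) - c t| - ((c s : ℚ) - c t) ^ 2) := by
    have aux : ∀ s t, c t ≤ c s → (K - 1) * (cyclicCut h ((c s : ZMod h) - c t) : ℚ) ≤
        (h - 1) * (K * |(c s : ℚ) - c t| - ((c s : ℚ) - c t) ^ 2) := by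
      intro s t hle
      have h2 := cyclicCut_le_of_le hh hK (x := c s - c t) ((Nat.sub_le _ _).trans (hc s))
      rw [Nat.cast_sub hle, Nat.cast_sub hle] at h2
      have h3 : (c t : ℚ) ≤ c s := by exact_mod_cast hle
      rw [abs_of_nonneg (by linarith)]
      linear_combination h2
    intro s t
    rcases Nat.le_total (c t) (c s) with hle | hle
    · exact aux s t hle
    · have := aux t s hle
      rw [← cyclicCut_neg, neg_sub, abs_sub_comm] at this
      linear_combination this
  have h2 : ((h : ℚ) - 1) * (2 * (K - 1) * (r * (h - r))) ≤ ((h : ℚ) - 1) *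
      ∑ s ∈ range h, ∑ t ∈ range h, (K * |(c s : ℚ) - c t| - ((c s : ℚ) - c t) ^ 2) := by
    calc ((h : ℚ) - 1) * (2 * (K - 1) * (r * (h - r)))
        = (K - 1) * (2 * ((h : ℚ) - 1) * (r * (h - r))) := by ring
      _ ≤ (K - 1) * ∑ s ∈ range h, ∑ t ∈ range h, (cyclicCut h ((c s : ZMod h) - c t) : ℚ) :=
          mul_le_mul_of_nonneg_left h1q hK1
      _ ≤ _ := by
          simp only [Finset.mul_sum]
          exact Finset.sum_le_sum fun s _ => Finset.sum_le_sum fun t _ => hpt s t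
  exact le_of_mul_le_mul_left h2 (by linarith)

theorem sum_abs_sub_eq (c : ℕ → ℕ) (h : ℕ) :
    ∑ s ∈ range h, ∑ t ∈ range h, |(c s : ℚ) - c t| =
      2 * (h * ((∑ t ∈ range h, c t : ℕ) : ℚ) -
        ((∑ s ∈ range h, ∑ t ∈ range h, min (c s) (c t) : ℕ) : ℚ)) := by
  have : ∀ s t, |(c s : ℚ) - c t| = c s + c t - 2 * ((min (c s) (c t) : ℕ) : ℚ) := by
    intro s t
    rw [Nat.cast_min]
    rcases le_total (c s : ℚ) (c t) with hle | hle
    · rw [min_eq_left hle, abs_of_nonpos (by linarith)]; ring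
    · rw [min_eq_right hle, abs_of_nonneg (by linarith)]; ring
  simp only [this, Finset.sum_sub_distrib, Finset.sum_add_distrib, Finset.sum_const, card_range,
    nsmul_eq_mul, ← Finset.mul_sum]
  push_cast
  ring

theorem sum_sq_sub_eq (c : ℕ → ℕ) (h : ℕ) :
    ∑ s ∈ range h, ∑ t ∈ range h, ((c s : ℚ) - c t) ^ 2 =
      2 * (h * ((∑ t ∈ range h, c t ^ 2 : ℕ) : ℚ) - ((∑ t ∈ range h, c t : ℕ) : ℚ) ^ 2) := by
  have : ∀ s t, ((c s : ℚ) - c t) ^ 2 = (c s : ℚ) ^ 2 + (c t : ℚ) ^ 2 - 2 * (c s * c t) := by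
    intro s t; ring
  simp only [this, Finset.sum_sub_distrib, Finset.sum_add_distrib, Finset.sum_const, card_range,
    nsmul_eq_mul, ← Finset.mul_sum, ← Finset.sum_mul]
  push_cast
  ring

/-- For given column sizes `c y`, the cut inside the rows is at least its value for nested columns,
where the overlaps are `min (c s) (c t)`. Both cuts then become sums over pairs of columns of |δ|
and δ², with δ the difference of their sizes. -/
theorem belowOptimal_pair {k h : ℕ} (hh : 2 ≤ h) (hkh : k = h ∨ 2 * h + 1 ≤ k) :
    BelowOptimal [k, h] := by
  intro f hf
  have hhq : (2 : ℚ) ≤ h := by exact_mod_cast hh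
  have hle : (h : ℚ) ≤ k := by exact_mod_cast (show h ≤ k by omega)
  have hprod : [k, h].prod = k * h := by simp
  rw [hprod]
  let c : ℕ → ℕ := fun y => ∑ a ∈ range k, f (a * h + y)
  have hc : ∀ t, c t ≤ k := fun t => sum_le_of_le_one (fun a => hf _) k
  set m := ∑ x ∈ range (k * h), f x with hm
  have hmle : m ≤ k * h := sum_le_of_le_one hf _
  have hmc : ∑ t ∈ range h, c t = m := by rw [hm, sum_range_mul_eq, Finset.sum_comm]
  -- Allowing r = h keeps q < k even for the full set.
  obtain ⟨q, r, hq, hr, hmqr⟩ : ∃ q r, q < k ∧ r ≤ h ∧ m = q * h + r := by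
    rcases hmle.eq_or_lt with he | hlt
    · refine ⟨k - 1, h, by omega, le_rfl, ?_⟩
      rw [he]
      obtain ⟨j, rfl⟩ : ∃ j, k = j + 1 := ⟨k - 1, by omega⟩
      rw [Nat.add_sub_cancel, Nat.succ_mul]
    · refine ⟨m / h, m % h, ?_, (Nat.mod_lt _ (by omega)).le, (Nat.div_add_mod' _ _).symm⟩
      rwa [Nat.div_lt_iff_lt_mul (by omega)]
  have hlow := cliqueEnergy_cons_below (k := k) (ks := [h]) (q := q) (r := r) hq (by simpa using hr)
  rw [List.prod_singleton, ← hmqr, cliqueEnergy_singleton, sum_below hr] at hlow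
  rw [hlow]
  have hE : cliqueEnergy [k, h] f = ∑ a ∈ range k, cliqueCut h (∑ y ∈ range h, f (a * h + y)) +
      ∑ y ∈ range h, cliqueCut k (c y) := by
    rw [cliqueEnergy]
    simp only [cliqueEnergy_singleton, List.prod_singleton, c]
  rw [hE, sum_cliqueCut_eq, sum_cliqueCut_eq, hmc, ← sum_range_mul_eq k h f, ← hm]
  have hsq := sum_sq_le_sum_min (F := fun y a => f (a * h + y)) (fun _ _ => hf _) h k
  have hsq' : ((∑ a ∈ range k, (∑ y ∈ range h, f (a * h + y)) ^ 2 : ℕ) : ℚ) ≤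
      ((∑ s ∈ range h, ∑ t ∈ range h, min (c s) (c t) : ℕ) : ℚ) := by exact_mod_cast hsq
  set X : ℚ := ((∑ s ∈ range h, ∑ t ∈ range h, min (c s) (c t) : ℕ) : ℚ) with hX
  set Y : ℚ := ((∑ y ∈ range h, c y ^ 2 : ℕ) : ℚ) with hY
  set Z : ℚ := ((∑ a ∈ range k, (∑ y ∈ range h, f (a * h + y)) ^ 2 : ℕ) : ℚ) with hZ
  have hdh : (0 : ℚ) < (h : ℚ) ^ 2 - 1 := by nlinarith
  have hdk : (0 : ℚ) < (k : ℚ) ^ 2 - 1 := by nlinarith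
  -- With this K, h times the energy divided by 4/(k² - 1) is bounded below by a constant plus half
  -- the sum of K|δ| - δ² over ordered pairs of columns.
  set K : ℚ := h * (((k : ℚ) ^ 2 - 1) / ((h : ℚ) ^ 2 - 1)) with hKdef
  have hK : (k = h ∧ K = h) ∨ (2 * h + 1 ≤ k ∧ (k : ℚ) ^ 2 ≤ K * h) := by
    rcases hkh with rfl | hlt
    · left
      exact ⟨rfl, by rw [hKdef, div_self hdh.ne', mul_one]⟩
    · right
      refine ⟨hlt, ?_⟩
      have : K * h = (h : ℚ) ^ 2 * ((k : ℚ) ^ 2 - 1) / ((h : ℚ) ^ 2 - 1) := by rw [hKdef]; ring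
      rw [this, le_div_iff₀ hdh]
      nlinarith
  have key := sum_diff_bound hh hK hc hr (hmc.trans hmqr)
  simp only [Finset.sum_sub_distrib, ← Finset.mul_sum] at key
  have hX2 := sum_abs_sub_eq c h
  have hY2 := sum_sq_sub_eq c h
  rw [hmc] at hX2 hY2
  rw [hX2, hY2] at key
  have hmq : (m : ℚ) = q * h + r := by exact_mod_cast hmqr
  have hWpos : (0 : ℚ) ≤ 4 / ((h : ℚ) ^ 2 - 1) := by positivity
  have hVpos : (0 : ℚ) < 4 / ((k : ℚ) ^ 2 - 1) := by positivity
  have hVW : (h : ℚ) * (4 / ((h : ℚ) ^ 2 - 1)) = K * (4 / ((k : ℚ) ^ 2 - 1)) := by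
    rw [hKdef]; field_simp
  have h1 : 4 / ((h : ℚ) ^ 2 - 1) * (h * m - X) ≤ 4 / ((h : ℚ) ^ 2 - 1) * (h * m - Z) :=
    mul_le_mul_of_nonneg_left (by linarith) hWpos
  refine le_trans ?_ (add_le_add_left h1 _)
  unfold cliqueCut
  push_cast
  set W : ℚ := 4 / ((h : ℚ) ^ 2 - 1) with hW
  set V : ℚ := 4 / ((k : ℚ) ^ 2 - 1) with hV
  refine le_of_mul_le_mul_left (a := (h : ℚ)) ?_ (by linarith)
  have key' := mul_le_mul_of_nonneg_left key hVpos.le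
  rw [hmq] at key' ⊢
  linear_combination (1 / 2) * key' + ((r : ℚ) * (h - r) - (h * (q * h + r) - X)) * hVW

/-! ### Isoperimetry with any number of factors -/

/-- Lexicographic initial segments minimize the dimension-normalized edge boundary. -/
theorem belowOptimal_of_pairwise {ks : List ℕ} (h2 : ∀ k ∈ ks, 2 ≤ k)
    (hp : ks.Pairwise fun k h => k = h ∨ 2 * h + 1 ≤ k) : BelowOptimal ks := by
  obtain ⟨n, hn⟩ : ∃ n, ks.length = n := ⟨_, rfl⟩
  induction n using Nat.strong_induction_on generalizing ks with
  | _ n ih =>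
  match ks, hn with
  | [], _ => intro f _; simp [cliqueEnergy]
  | [h], _ =>
    intro f hf
    rw [cliqueEnergy_singleton, cliqueEnergy_singleton, List.prod_singleton,
      sum_below (sum_le_of_le_one hf _)]
  | [k, h], _ => exact belowOptimal_pair (h2 h (by simp)) (by simpa using hp)
  | k :: j :: l :: ls, hn =>
    -- Removing the first or the last of at least three factors leaves a shorter list to which the
    -- induction applies, and the factors in between have product at least 2.
    obtain ⟨mid, h, hmh⟩ : ∃ mid h, l :: ls = mid ++ [h] :=
      ⟨_, _, (List.dropLast_append_getLast (List.cons_ne_nil l ls)).symm⟩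
    rw [hmh] at h2 hp hn ⊢
    have e : j :: (mid ++ [h]) = (j :: mid) ++ [h] := rfl
    rw [e] at h2 hp hn ⊢
    have hpk := (List.pairwise_cons.1 hp).1 h (by simp)
    have hm2 : ∀ i ∈ j :: mid, 2 ≤ i := fun i hi => h2 i (by
      simp only [List.mem_cons, List.mem_append] at hi ⊢; tauto)
    refine belowOptimal_of_compression (h2 h (by simp)) (by omega)
      (fun i hi => (hm2 i hi).trans' (by norm_num)) ?_ ?_ ?_
    · rw [List.prod_cons]
      have h3 : 1 ≤ mid.prod := List.one_le_prod fun i hi =>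
        (hm2 i (List.mem_cons_of_mem _ hi)).trans' (by norm_num)
      have h4 := hm2 j List.mem_cons_self
      nlinarith
    · refine ih _ ?_ (fun i hi => h2 i (List.mem_cons_of_mem _ hi)) (List.pairwise_cons.1 hp).2 rfl
      simp at hn ⊢; omega
    · have hsub : List.Sublist (k :: j :: mid) (k :: (j :: mid ++ [h])) :=
        List.Sublist.cons_cons _ (List.sublist_append_left _ _)
      refine ih _ ?_ (fun i hi => h2 i (hsub.subset hi)) (hp.sublist hsub) rfl
      simp at hn ⊢; omega

/-! ### Comparison of trees with weighted complete graphs -/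

/-- The number of edges of the complete binary tree on `k` vertices cut by the set with indicator
function `g`, each edge being listed by its lower end. -/
def treeCut (k : ℕ) (g : ℕ → ℕ) : ℕ :=
  ∑ w ∈ range k, if g w ≠ g ((w - 1) / 2) then 1 else 0

/-- `subtree w u` is `1` if `w ≠ 0` is an ancestor of `u` or `u` itself, and `0` otherwise. -/
def subtree (w : ℕ) : ℕ → ℕ
  | 0 => 0
  | u + 1 => if w = u + 1 then 1 else subtree w (u / 2)
termination_by u => u
decreasing_by omega

theorem subtree_zero (w : ℕ) : subtree w 0 = 0 := by rw [subtree]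

theorem subtree_succ (w u : ℕ) :
    subtree w (u + 1) = if w = u + 1 then 1 else subtree w (u / 2) := by rw [subtree]

theorem subtree_le_one (w u : ℕ) : subtree w u ≤ 1 := by
  induction u using Nat.strong_induction_on with
  | _ u ih =>
    rcases u with _ | u
    · rw [subtree_zero]; omega
    · rw [subtree_succ]
      split_ifs
      · rfl
      · exact ih _ (by omega)

theorem subtree_eq_zero {w u : ℕ} (h : u < w) : subtree w u = 0 := by
  induction u using Nat.strong_induction_on with
  | _ u ih =>
    rcases u with _ | u
    · rw [subtree_zero]
    · rw [subtree_succ, if_neg (by omega)]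
      exact ih _ (by omega) (by omega)

/-- Telescoping along the path from the root to u, whose edges are named by their lower ends w. The
term w = 0 vanishes. -/
theorem sub_root_eq_sum_subtree (g : ℕ → ℤ) {k u : ℕ} (hu : u < k) :
    g u - g 0 = ∑ w ∈ range k, (subtree w u : ℤ) * (g w - g ((w - 1) / 2)) := by
  induction u using Nat.strong_induction_on with
  | _ u ih =>
    rcases u with _ | u
    · simp [subtree_zero]
    · have h1 := ih (u / 2) (by omega) (by omega)
      have h2 : ∀ w ∈ range k, (subtree w (u + 1) : ℤ) * (g w - g ((w - 1) / 2)) =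
          (subtree w (u / 2) : ℤ) * (g w - g ((w - 1) / 2)) +
            if w = u + 1 then g (u + 1) - g (u / 2) else 0 := by
        intro w _
        rw [subtree_succ]
        split_ifs with h
        · subst h
          rw [subtree_eq_zero (show u / 2 < u + 1 by omega)]
          simp
        · simp
      rw [Finset.sum_congr rfl h2, Finset.sum_add_distrib, ← h1, Finset.sum_ite_eq' (range k),
        if_pos (by simpa using hu)]
      ring

theorem sum_abs_sub_of_le_one {x : ℕ → ℕ} (hx : ∀ u, x u ≤ 1) (k : ℕ) :
    ∑ u ∈ range k, ∑ v ∈ range k, |(x u : ℤ) - x v| =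
      2 * (((∑ u ∈ range k, x u : ℕ) : ℤ) * (k - ((∑ u ∈ range k, x u : ℕ) : ℤ))) := by
  have : ∀ u v, |(x u : ℤ) - x v| = x u + x v - 2 * (x u * x v) := by
    intro u v
    have h1 := hx u
    have h2 := hx v
    interval_cases x u <;> interval_cases x v <;> simp
  simp only [this, Finset.sum_sub_distrib, Finset.sum_add_distrib, Finset.sum_const, card_range,
    nsmul_eq_mul, ← Finset.mul_sum, ← Finset.sum_mul]
  push_cast
  ring

/-- Every separated pair is charged to the cut edges on its tree path. The edge above w lies on the
paths of s(k - s) pairs, where s is the size of the subtree at w. -/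
theorem four_mul_le_treeCut {k : ℕ} (hk : Odd k) {g : ℕ → ℕ} (hg : ∀ u, g u ≤ 1) :
    4 * (((∑ u ∈ range k, g u : ℕ) : ℤ) * (k - ((∑ u ∈ range k, g u : ℕ) : ℤ))) ≤
      ((k : ℤ) ^ 2 - 1) * treeCut k g := by
  have h1 := sum_abs_sub_of_le_one hg k
  have h2 : ∀ u ∈ range k, ∀ v ∈ range k, |(g u : ℤ) - g v| ≤ ∑ w ∈ range k,
      |(subtree w u : ℤ) - subtree w v| * |(g w : ℤ) - g ((w - 1) / 2)| := by
    intro u hu v hv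
    have e : (g u : ℤ) - g v = ∑ w ∈ range k,
        ((subtree w u : ℤ) - subtree w v) * ((g w : ℤ) - g ((w - 1) / 2)) := by
      have e1 := sub_root_eq_sum_subtree (fun u => (g u : ℤ)) (Finset.mem_range.1 hu)
      have e2 := sub_root_eq_sum_subtree (fun u => (g u : ℤ)) (Finset.mem_range.1 hv)
      simp only [sub_mul _ _ ((g _ : ℤ) - g _), Finset.sum_sub_distrib]
      linear_combination e1 - e2
    rw [e]
    refine (Finset.abs_sum_le_sum_abs _ _).trans_eq ?_
    exact Finset.sum_congr rfl fun w _ => abs_mul _ _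
  have h3 : ∑ u ∈ range k, ∑ v ∈ range k, |(g u : ℤ) - g v| ≤ ∑ w ∈ range k,
      (∑ u ∈ range k, ∑ v ∈ range k, |(subtree w u : ℤ) - subtree w v|) *
        |(g w : ℤ) - g ((w - 1) / 2)| := by
    calc _ ≤ ∑ u ∈ range k, ∑ v ∈ range k, ∑ w ∈ range k,
          |(subtree w u : ℤ) - subtree w v| * |(g w : ℤ) - g ((w - 1) / 2)| :=
          Finset.sum_le_sum fun u hu => Finset.sum_le_sum fun v hv => h2 u hu v hv
      _ = _ := by
          simp only [Finset.sum_mul]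
          rw [Finset.sum_congr rfl fun u _ => Finset.sum_comm, Finset.sum_comm]
  have h4 : ∀ w, 2 * ∑ u ∈ range k, ∑ v ∈ range k, |(subtree w u : ℤ) - subtree w v| ≤
      (k : ℤ) ^ 2 - 1 := by
    intro w
    rw [sum_abs_sub_of_le_one (subtree_le_one w) k]
    set s : ℤ := ((∑ u ∈ range k, subtree w u : ℕ) : ℤ)
    obtain ⟨j, rfl⟩ := hk
    push_cast
    -- No integer s lies strictly between j and j + 1; with k = 2j + 1 this is 4s(k - s) ≤ k² - 1.
    have h5 : 0 ≤ ((j : ℤ) - s) * (j + 1 - s) := by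
      rcases le_or_gt s j with h | h
      · apply mul_nonneg <;> omega
      · apply mul_nonneg_of_nonpos_of_nonpos <;> omega
    linear_combination 4 * h5
  have h6 : ∀ w, |(g w : ℤ) - g ((w - 1) / 2)| = if g w ≠ g ((w - 1) / 2) then 1 else 0 := by
    intro w
    have a1 := hg w
    have a2 := hg ((w - 1) / 2)
    interval_cases g w <;> interval_cases g ((w - 1) / 2) <;> simp
  have h7 : (treeCut k g : ℤ) = ∑ w ∈ range k, |(g w : ℤ) - g ((w - 1) / 2)| := by
    simp only [h6, treeCut]; push_cast; rfl
  have h8 : 2 * ∑ u ∈ range k, ∑ v ∈ range k, |(g u : ℤ) - g v| ≤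
      ((k : ℤ) ^ 2 - 1) * treeCut k g := by
    rw [h7, Finset.mul_sum (range k) _ ((k : ℤ) ^ 2 - 1)]
    refine (mul_le_mul_of_nonneg_left h3 (by norm_num)).trans ?_
    rw [Finset.mul_sum]
    refine Finset.sum_le_sum fun w _ => ?_
    rw [← mul_assoc]
    exact mul_le_mul_of_nonneg_right (h4 w) (abs_nonneg _)
  rw [h1] at h8
  linarith

theorem cliqueCut_le_treeCut {k : ℕ} (h2 : 2 ≤ k) (hk : Odd k) {g : ℕ → ℕ} (hg : ∀ u, g u ≤ 1) :
    cliqueCut k (∑ u ∈ range k, g u) ≤ treeCut k g := by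
  have h := four_mul_le_treeCut hk hg
  have hq : 4 * (((∑ u ∈ range k, g u : ℕ) : ℚ) * (k - ((∑ u ∈ range k, g u : ℕ) : ℚ))) ≤
      ((k : ℚ) ^ 2 - 1) * treeCut k g := by exact_mod_cast h
  have hkq : (2 : ℚ) ≤ k := by exact_mod_cast h2
  unfold cliqueCut
  rw [div_mul_eq_mul_div, div_le_iff₀ (by nlinarith)]
  linarith

/-- The number of edges of the product of complete binary trees whose orders are listed, cut by the
set with indicator function `f`. The vertices are numbered lexicographically. -/
def treeEnergy : List ℕ → (ℕ → ℕ) → ℕ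
  | [], _ => 0
  | k :: ks, f => ∑ a ∈ range k, treeEnergy ks (fun y => f (a * ks.prod + y)) +
      ∑ y ∈ range ks.prod, treeCut k (fun a => f (a * ks.prod + y))

theorem cliqueEnergy_le_treeEnergy {ks : List ℕ} (h : ∀ k ∈ ks, 2 ≤ k ∧ Odd k) {f : ℕ → ℕ}
    (hf : ∀ x, f x ≤ 1) : cliqueEnergy ks f ≤ treeEnergy ks f := by
  induction ks generalizing f with
  | nil => simp [cliqueEnergy, treeEnergy]
  | cons k ks ih =>
    rw [cliqueEnergy, treeEnergy]
    push_cast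
    obtain ⟨h2, hk⟩ := h k List.mem_cons_self
    exact add_le_add
      (Finset.sum_le_sum fun a _ => ih (fun k hk => h k (List.mem_cons_of_mem _ hk)) fun y => hf _)
      (Finset.sum_le_sum fun y _ => cliqueCut_le_treeCut h2 hk fun a => hf _)

/-! ### The value at one half and a bisection attaining it -/

/-- `∑_i ∏_{j > i} k_j`. -/
def suffixProductSum : List ℕ → ℕ
  | [] => 0
  | _ :: ks => ks.prod + suffixProductSum ks

theorem odd_prod {ks : List ℕ} (h : ∀ k ∈ ks, Odd k) : Odd ks.prod := by
  induction ks with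
  | nil => simp
  | cons k ks ih =>
    rw [List.prod_cons]
    exact (h k List.mem_cons_self).mul (ih fun k hk => h k (List.mem_cons_of_mem _ hk))

theorem prod_cons_div_two {k : ℕ} (hk : Odd k) {N : ℕ} (hN : Odd N) :
    k * N / 2 = k / 2 * N + N / 2 := by
  obtain ⟨i, rfl⟩ := hk
  obtain ⟨j, rfl⟩ := hN
  have e1 : (2 * i + 1) * (2 * j + 1) = 2 * (i * (2 * j + 1) + j) + 1 := by ring
  have e2 : (2 * i + 1) / 2 = i := by omega
  have e3 : (2 * j + 1) / 2 = j := by omega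
  rw [e1, e2, e3]
  omega

/-- For odd k, both (k - 1)/2 and (k + 1)/2 give `cliqueCut` exactly 1, so the first direction costs
one unit per line and the remainder is again a half segment. -/
theorem cliqueEnergy_below_half {ks : List ℕ} (h : ∀ k ∈ ks, 2 ≤ k ∧ Odd k) :
    cliqueEnergy ks (below (ks.prod / 2)) = suffixProductSum ks := by
  induction ks with
  | nil => simp [cliqueEnergy, suffixProductSum]
  | cons k ks ih =>
    obtain ⟨h2, hk⟩ := h k List.mem_cons_self
    have hks : ∀ k ∈ ks, 2 ≤ k ∧ Odd k := fun k hk => h k (List.mem_cons_of_mem _ hk)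
    have hN : Odd ks.prod := odd_prod fun k hk => (hks k hk).2
    rw [List.prod_cons, prod_cons_div_two hk hN,
      cliqueEnergy_cons_below (by omega) (Nat.div_le_self _ _), ih hks, suffixProductSum]
    have hkq : (2 : ℚ) ≤ k := by exact_mod_cast h2
    have c0 : cliqueCut k (k / 2) = 1 ∧ cliqueCut k (k / 2 + 1) = 1 := by
      obtain ⟨i, rfl⟩ := hk
      have e2 : (2 * i + 1) / 2 = i := by omega
      have hd : ((2 * i + 1 : ℕ) : ℚ) ^ 2 - 1 ≠ 0 := by nlinarith
      unfold cliqueCut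
      rw [e2]
      push_cast at hd ⊢
      constructor <;> field_simp <;> ring
    rw [c0.1, c0.2]
    push_cast
    ring

/-- Away from the root, both children of a vertex belong to the subtree at 1 exactly when the vertex
does. A new level thus doubles the count, and the root adds one for its child 1. -/
theorem sum_subtree_one (l : ℕ) : ∑ u ∈ range (2 ^ (l + 1) - 1), subtree 1 u = 2 ^ l - 1 := by
  have double : ∀ n, ∑ u ∈ range (2 * n + 1), subtree 1 u =
      ∑ p ∈ range n, (subtree 1 (2 * p + 1) + subtree 1 (2 * p + 2)) := by
    intro n
    induction n with
    | zero => simp [subtree_zero]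
    | succ n ih =>
      rw [Finset.sum_range_succ _ n, ← ih, show 2 * (n + 1) + 1 = 2 * n + 1 + 1 + 1 by ring,
        Finset.sum_range_succ, Finset.sum_range_succ]
      ring_nf
  induction l with
  | zero => simp [subtree_zero]
  | succ l ih =>
    have hpos : 1 ≤ 2 ^ l := Nat.one_le_two_pow
    obtain ⟨j, hj⟩ : ∃ j, 2 ^ (l + 1) - 1 = j + 1 := ⟨2 ^ (l + 1) - 2, by rw [pow_succ]; omega⟩
    have e : 2 ^ (l + 1 + 1) - 1 = 2 * (j + 1) + 1 := by rw [← hj, pow_succ, pow_succ]; omega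
    rw [e, double, Finset.sum_range_succ']
    rw [hj, Finset.sum_range_succ', subtree_zero, add_zero] at ih
    have h1 : ∀ p ∈ range j, subtree 1 (2 * (p + 1) + 1) + subtree 1 (2 * (p + 1) + 2) =
        2 * subtree 1 (p + 1) := by
      intro p _
      rw [subtree_succ, subtree_succ, if_neg (by omega), if_neg (by omega),
        show 2 * (p + 1) / 2 = p + 1 by omega, show (2 * (p + 1) + 1) / 2 = p + 1 by omega]
      ring
    rw [Finset.sum_congr rfl h1, ← Finset.mul_sum, ih]
    have h2 : subtree 1 (2 * 0 + 1) = 1 := by rw [subtree_succ]; simp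
    have h3 : subtree 1 (2 * 0 + 2) = 0 := by rw [subtree_succ]; simp [subtree_zero]
    rw [h2, h3, pow_succ]
    omega

theorem treeEnergy_congr {ks : List ℕ} {f g : ℕ → ℕ} (h : ∀ x < ks.prod, f x = g x) :
    treeEnergy ks f = treeEnergy ks g := by
  induction ks generalizing f g with
  | nil => rfl
  | cons k ks ih =>
    rw [List.prod_cons] at h
    unfold treeEnergy
    congr 1
    · refine Finset.sum_congr rfl fun a ha => ih fun y hy => h _ (index_lt (by simpa using ha) hy)
    · refine Finset.sum_congr rfl fun y hy => Finset.sum_congr rfl fun w hw => ?_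
      have h1 : w < k := by simpa using hw
      have hy : y < ks.prod := by simpa using hy
      simp only [h _ (index_lt h1 hy), h _ (index_lt (show (w - 1) / 2 < k by omega) hy)]

theorem treeEnergy_const (ks : List ℕ) (c : ℕ) : treeEnergy ks (fun _ => c) = 0 := by
  induction ks with
  | nil => rfl
  | cons k ks ih => simp [treeEnergy, ih, treeCut]

/-- A bisection: half of the slices, given by a subtree of the root in the first coordinate, and
recursively half of the slice over the root. -/
theorem exists_bisection {ks : List ℕ} (h : ∀ k ∈ ks, ∃ l, 2 ≤ l ∧ k = 2 ^ l - 1) :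
    ∃ f : ℕ → ℕ, (∀ x, f x ≤ 1) ∧ ∑ x ∈ range ks.prod, f x = ks.prod / 2 ∧
      treeEnergy ks f = suffixProductSum ks := by
  induction ks with
  | nil => exact ⟨fun _ => 0, by simp, by simp, rfl⟩
  | cons k ks ih =>
    obtain ⟨f, hf, hs, hE⟩ := ih fun k hk => h k (List.mem_cons_of_mem _ hk)
    have hodd : ∀ j ∈ k :: ks, Odd j := by
      intro j hj
      obtain ⟨l, hl, rfl⟩ := h j hj
      exact Nat.Even.sub_odd Nat.one_le_two_pow (Nat.even_pow.2 ⟨even_two, by omega⟩) odd_one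
    have hNodd : Odd ks.prod := odd_prod fun k hk => hodd k (List.mem_cons_of_mem _ hk)
    have hkodd := hodd k List.mem_cons_self
    set N := ks.prod with hN
    have hNpos : 0 < N := hNodd.pos
    obtain ⟨l, hl, hkl⟩ := h k List.mem_cons_self
    obtain ⟨i, rfl⟩ : ∃ i, l = i + 1 + 1 := ⟨l - 2, by omega⟩
    have hpos : 1 ≤ 2 ^ i := Nat.one_le_two_pow
    obtain ⟨j, rfl⟩ : ∃ j, k = j + 3 := ⟨k - 3, by rw [hkl, pow_succ, pow_succ]; omega⟩
    have hleft : ∑ a ∈ range (j + 3), subtree 1 a = (j + 3) / 2 := by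
      rw [hkl, sum_subtree_one, pow_succ _ (i + 1)]; omega
    let F : ℕ → ℕ := fun x => if x < N then f x else subtree 1 (x / N)
    have hF0 : ∀ y < N, F (0 * N + y) = f y := by
      intro y hy; simp [F, hy]
    have hF1 : ∀ a, a ≠ 0 → ∀ y < N, F (a * N + y) = subtree 1 a := by
      intro a ha y hy
      have h1 : N ≤ a * N := Nat.le_mul_of_pos_left N (by omega)
      have h2 : ¬ (a * N + y < N) := by omega
      simp only [F, h2, if_false]
      rw [mul_comm, Nat.mul_add_div hNpos, Nat.div_eq_of_lt hy, add_zero]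
    refine ⟨F, fun x => ?_, ?_, ?_⟩
    · simp only [F]; split_ifs
      · exact hf x
      · exact subtree_le_one _ _
    · rw [List.prod_cons, prod_cons_div_two hkodd hNodd, ← hN, sum_range_mul_eq,
        Finset.sum_range_succ']
      rw [Finset.sum_range_succ', subtree_zero, add_zero] at hleft
      rw [← hleft, ← hs, Finset.sum_mul]
      congr 1
      · refine Finset.sum_congr rfl fun a _ => ?_
        rw [Finset.sum_congr rfl fun y hy => hF1 (a + 1) (by omega) y (by simpa using hy)]
        simp [mul_comm]
      · exact Finset.sum_congr rfl fun y hy => hF0 y (by simpa using hy)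
    · rw [treeEnergy, suffixProductSum, ← hN, add_comm]
      congr 1
      · have h1 : ∀ y ∈ range N, treeCut (j + 3) (fun a => F (a * N + y)) = 1 := by
          intro y hy
          have hy : y < N := by simpa using hy
          have v1 : subtree 1 1 = 1 := by rw [subtree_succ]; simp
          have v2 : subtree 1 2 = 0 := by rw [subtree_succ]; simp [subtree_zero]
          unfold treeCut
          rw [add_comm j 3, Finset.sum_range_add, Finset.sum_eq_zero (s := range j)]
          · simp only [Finset.sum_range_succ, Finset.sum_range_zero]
            change (((0 + if F (0 * N + y) ≠ F (0 * N + y) then 1 else 0) +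
              if F (1 * N + y) ≠ F (0 * N + y) then 1 else 0) +
              if F (2 * N + y) ≠ F (0 * N + y) then 1 else 0) + 0 = 1
            rw [hF0 y hy, hF1 1 (by omega) y hy, hF1 2 (by omega) y hy, v1, v2]
            have := hf y
            interval_cases f y <;> simp
          · intro w _
            change (if F ((3 + w) * N + y) ≠ F ((3 + w - 1) / 2 * N + y) then 1 else 0) = 0
            have hw : subtree 1 (3 + w) = subtree 1 ((3 + w - 1) / 2) := by
              rw [show 3 + w = (2 + w) + 1 by ring, subtree_succ, if_neg (by omega),
                Nat.add_sub_cancel]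
            rw [hF1 _ (by omega) y hy, hF1 _ (by omega) y hy, hw]
            simp
        rw [Finset.sum_congr rfl h1]; simp
      · rw [Finset.sum_range_succ', Finset.sum_eq_zero, zero_add, ← hE]
        · exact treeEnergy_congr fun y hy => hF0 y hy
        · intro a _
          rw [← treeEnergy_const ks (subtree 1 (a + 1))]
          exact treeEnergy_congr fun y hy => hF1 (a + 1) (by omega) y hy

/-! ### From graphs to lexicographically numbered products -/

/-- The number of edges from the set where `χ = 1` to its complement. -/
noncomputable def cutCount {V : Type*} [Fintype V] (G : SimpleGraph V) (χ : V → ℕ) : ℕ :=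
  open Classical in ∑ x, ∑ y, if G.Adj x y ∧ χ x = 1 ∧ χ y ≠ 1 then 1 else 0

/-- A boundary edge has a unique orientation from inside to outside, so ordered pairs count each
edge once. -/
theorem ncard_edgeBoundary_eq {V : Type*} [Fintype V] (G : SimpleGraph V) (S : Finset V)
    {χ : V → ℕ} (hχ : ∀ x, χ x = 1 ↔ x ∈ S) : (edgeBoundary G S).ncard = cutCount G χ := by
  classical
  set T : Finset (V × V) := {p | G.Adj p.1 p.2 ∧ χ p.1 = 1 ∧ χ p.2 ≠ 1} with hT
  have h1 : edgeBoundary G S = (fun p : V × V => s(p.1, p.2)) '' (T : Set (V × V)) := by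
    ext e
    simp only [edgeBoundary, Set.mem_ofPred_eq, Set.mem_image, hT, Finset.coe_filter,
      Finset.mem_univ, true_and, Prod.exists, hχ]
    constructor
    · rintro ⟨he, u, hu, v, hv, rfl⟩
      exact ⟨u, v, ⟨by simpa using he, hu, by simpa [hχ] using hv⟩, rfl⟩
    · rintro ⟨u, v, ⟨hadj, hu, hv⟩, rfl⟩
      exact ⟨by simpa using hadj, u, hu, v, by simpa [hχ] using hv, rfl⟩
  rw [h1, Set.InjOn.ncard_image, Set.ncard_coe_finset]
  · unfold cutCount
    rw [← Fintype.sum_prod_type', hT, Finset.card_filter]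
  · rintro ⟨u, v⟩ hp ⟨u', v'⟩ hp' heq
    simp only [hT, Finset.coe_filter, Finset.mem_univ, true_and, Set.mem_ofPred_eq] at hp hp'
    rcases Sym2.eq_iff.1 heq with ⟨rfl, rfl⟩ | ⟨rfl, rfl⟩
    · rfl
    · exact absurd hp.2.1 hp'.2.2

theorem cutCount_completeBinaryTree (k : ℕ) {g : ℕ → ℕ} (hg : ∀ x, g x ≤ 1) :
    cutCount (completeBinaryTree k) (fun x => g x) = treeCut k g := by
  classical
  -- The summands separate the cut edges with the parent in the set from those with the child in it;
  -- summing over the parent leaves a sum over lower ends.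
  have h1 : ∀ x y : Fin k, (if (completeBinaryTree k).Adj x y ∧ g x = 1 ∧ g y ≠ 1 then 1 else 0) =
      (if x.val = (y.val - 1) / 2 ∧ (g y ≠ g ((y.val - 1) / 2) ∧ g y = 0) then 1 else 0) +
      (if y.val = (x.val - 1) / 2 ∧ (g x ≠ g ((x.val - 1) / 2) ∧ g x = 1) then 1 else 0) := by
    intro x y
    have hx := hg x
    have hy := hg y
    -- Truncated subtraction makes the root its own parent, hence the conditions that the lower end
    -- is not 0.
    have hadj : (completeBinaryTree k).Adj x y ↔
        (x.val = (y.val - 1) / 2 ∧ y.val ≠ 0) ∨ (y.val = (x.val - 1) / 2 ∧ x.val ≠ 0) := by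
      simp only [completeBinaryTree]; omega
    rw [hadj]
    by_cases ha : x.val = (y.val - 1) / 2 <;> by_cases hb : y.val = (x.val - 1) / 2
    · have hxy : x.val = 0 ∧ y.val = 0 := by omega
      simp [hxy.1, hxy.2]
    · by_cases hy0 : y.val = 0
      · have : x.val = 0 := by omega
        exact absurd (by omega) hb
      · simp only [← ha, hb]
        interval_cases g x.val <;> interval_cases g y.val <;> simp [hy0]
    · by_cases hx0 : x.val = 0
      · have : y.val = 0 := by omega
        exact absurd (by omega) ha
      · simp only [← hb, ha]
        interval_cases g x.val <;> interval_cases g y.val <;> simp [hx0]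
    · simp [ha, hb]
  have h2 : ∀ (w : Fin k) (p : Prop) [Decidable p],
      ∑ x : Fin k, (if x.val = (w.val - 1) / 2 ∧ p then 1 else 0) = if p then 1 else 0 := by
    intro w p _
    rw [Finset.sum_eq_single_of_mem ⟨(w.val - 1) / 2, by omega⟩ (Finset.mem_univ _)]
    · simp
    · intro x _ hx
      rw [if_neg]
      rintro ⟨h, -⟩
      exact hx (Fin.ext h)
  unfold cutCount
  simp only [h1, Finset.sum_add_distrib]
  rw [Finset.sum_comm]
  simp only [h2]
  rw [← Finset.sum_add_distrib, treeCut, ← Fin.sum_univ_eq_sum_range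
    (fun w => if g w ≠ g ((w - 1) / 2) then 1 else 0)]
  refine Finset.sum_congr rfl fun w _ => ?_
  have hw := hg w
  interval_cases g w.val <;> simp

/-- Cuts in a product of graphs split along the first coordinate. -/
theorem cutCount_meshConnectedTrees_succ {d : ℕ} (k : Fin (d + 1) → ℕ)
    (χ : (∀ i, Fin (k i)) → ℕ) :
    cutCount (meshConnectedTrees k) χ =
      ∑ a : Fin (k 0), cutCount (meshConnectedTrees fun i : Fin d => k i.succ)
        (fun y => χ (Fin.cons a y)) +
      ∑ y : (∀ i : Fin d, Fin (k i.succ)), cutCount (completeBinaryTree (k 0))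
        (fun a => χ (Fin.cons a y)) := by
  classical
  have reindex : ∀ F : (∀ i, Fin (k i)) → ℕ, ∑ x, F x =
      ∑ a : Fin (k 0), ∑ y : (∀ i : Fin d, Fin (k i.succ)), F (Fin.cons a y) := by
    intro F
    rw [← Fintype.sum_prod_type' (f := fun (a : Fin (k 0))
      (y : ∀ i : Fin d, Fin (k i.succ)) => F (Fin.cons a y))]
    exact (Fintype.sum_equiv (Fin.consEquiv fun i => Fin (k i)) _ _ fun _ => rfl).symm
  have hadj : ∀ (a b : Fin (k 0)) (x y : ∀ i : Fin d, Fin (k i.succ)),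
      (meshConnectedTrees k).Adj (Fin.cons a x) (Fin.cons b y) ↔
        (x = y ∧ (completeBinaryTree (k 0)).Adj a b) ∨
        (a = b ∧ (meshConnectedTrees fun i : Fin d => k i.succ).Adj x y) := by
    intro a b x y
    simp only [meshConnectedTrees, cartesianProduct]
    constructor
    · rintro ⟨i, hi, hj⟩
      induction i using Fin.cases with
      | zero =>
        left
        exact ⟨funext fun j => by simpa using hj j.succ (Fin.succ_ne_zero j), by simpa using hi⟩
      | succ i =>
        right
        refine ⟨by simpa using hj 0 (Fin.succ_ne_zero i).symm, i, by simpa using hi,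
          fun j hji => by simpa using hj j.succ (by simpa using hji)⟩
    · rintro (⟨rfl, h⟩ | ⟨rfl, i, hi, hj⟩)
      · refine ⟨0, by simpa using h, fun j hj => ?_⟩
        induction j using Fin.cases with
        | zero => exact absurd rfl hj
        | succ j => simp
      · refine ⟨i.succ, by simpa using hi, fun j hji => ?_⟩
        induction j using Fin.cases with
        | zero => simp
        | succ j => simpa using hj j (by simpa using hji)
  have hsplit : ∀ (a b : Fin (k 0)) (x y : ∀ i : Fin d, Fin (k i.succ)),
      (if (meshConnectedTrees k).Adj (Fin.cons a x) (Fin.cons b y) ∧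
        χ (Fin.cons a x) = 1 ∧ χ (Fin.cons b y) ≠ 1 then 1 else 0) =
      (if x = y then if (completeBinaryTree (k 0)).Adj a b ∧
        χ (Fin.cons a x) = 1 ∧ χ (Fin.cons b y) ≠ 1 then 1 else 0 else 0) +
      (if a = b then if (meshConnectedTrees fun i : Fin d => k i.succ).Adj x y ∧
        χ (Fin.cons a x) = 1 ∧ χ (Fin.cons b y) ≠ 1 then 1 else 0 else 0) := by
    intro a b x y
    rw [hadj]
    by_cases hx : x = y
    · subst hx
      simp
    · simp [hx, ite_and]
  unfold cutCount
  rw [reindex]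
  simp only [reindex, hsplit, Finset.sum_add_distrib]
  rw [add_comm]
  congr 1
  · refine Finset.sum_congr rfl fun a _ => Finset.sum_congr rfl fun x _ => ?_
    rw [Finset.sum_comm]
    simp
  · rw [Finset.sum_comm]
    refine Finset.sum_congr rfl fun x _ => Finset.sum_congr rfl fun a _ =>
      Finset.sum_congr rfl fun b _ => ?_
    simp

/-- The position of a vertex in the lexicographic order. -/
def lexRank : {d : ℕ} → (k : Fin d → ℕ) → (∀ i, Fin (k i)) → ℕ
  | 0, _, _ => 0
  | _ + 1, k, x => (x 0).val * (List.ofFn fun i => k (Fin.succ i)).prod +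
      lexRank (fun i => k (Fin.succ i)) fun i => x (Fin.succ i)

theorem lexRank_cons {d : ℕ} (k : Fin (d + 1) → ℕ) (a : Fin (k 0))
    (y : ∀ i : Fin d, Fin (k i.succ)) : lexRank k (Fin.cons a y) =
      a.val * (List.ofFn fun i => k (Fin.succ i)).prod + lexRank (fun i => k (Fin.succ i)) y := rfl

theorem sum_lexRank {d : ℕ} (k : Fin d → ℕ) (F : ℕ → ℕ) :
    ∑ x, F (lexRank k x) = ∑ i ∈ range (List.ofFn k).prod, F i := by
  induction d generalizing F with
  | zero => simp [lexRank]
  | succ d ih =>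
    rw [List.ofFn_succ, List.prod_cons, sum_range_mul_eq,
      ← Fin.sum_univ_eq_sum_range (fun a => ∑ j ∈ range _, F (a * _ + j)),
      ← Fintype.sum_equiv (Fin.consEquiv fun i => Fin (k i))
        (fun p => F (lexRank k (Fin.cons p.1 p.2))) _ (fun _ => rfl), Fintype.sum_prod_type]
    refine Finset.sum_congr rfl fun a _ => ?_
    simp only [lexRank_cons]
    exact ih (fun i => k i.succ) fun j => F (a.val * (List.ofFn fun i => k (Fin.succ i)).prod + j)

theorem lexRank_lt {d : ℕ} (k : Fin d → ℕ) (x : ∀ i, Fin (k i)) :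
    lexRank k x < (List.ofFn k).prod := by
  induction d with
  | zero => simp [lexRank]
  | succ d ih =>
    rw [List.ofFn_succ, List.prod_cons]
    exact index_lt (x 0).isLt (ih _ _)

theorem lexRank_injective {d : ℕ} (k : Fin d → ℕ) : Function.Injective (lexRank k) := by
  induction d with
  | zero => intro x y _; exact Subsingleton.elim _ _
  | succ d ih =>
    intro x y hxy
    have hx := lexRank_lt (fun i => k (Fin.succ i)) fun i => x (Fin.succ i)
    have hy := lexRank_lt (fun i => k (Fin.succ i)) fun i => y (Fin.succ i)
    simp only [lexRank] at hxy
    set N := (List.ofFn fun i => k (Fin.succ i)).prod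
    have h0 : (x 0).val = (y 0).val := by
      have h1 := congrArg (· / N) hxy
      simpa [mul_comm _ N, Nat.mul_add_div (show 0 < N by omega), Nat.div_eq_of_lt hx,
        Nat.div_eq_of_lt hy] using h1
    rw [h0] at hxy
    have h1 := ih (fun i => k (Fin.succ i)) (Nat.add_left_cancel hxy)
    funext i
    induction i using Fin.cases with
    | zero => exact Fin.ext h0
    | succ i => exact congrFun h1 i

theorem cutCount_meshConnectedTrees {d : ℕ} (k : Fin d → ℕ) {f : ℕ → ℕ} (hf : ∀ x, f x ≤ 1) :
    cutCount (meshConnectedTrees k) (fun x => f (lexRank k x)) = treeEnergy (List.ofFn k) f := by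
  induction d generalizing f with
  | zero => simp [cutCount, meshConnectedTrees, cartesianProduct, treeEnergy]
  | succ d ih =>
    rw [cutCount_meshConnectedTrees_succ, List.ofFn_succ, treeEnergy]
    simp only [lexRank_cons]
    congr 1
    · rw [← Fin.sum_univ_eq_sum_range (fun a => treeEnergy _ fun y => f (a * _ + y))]
      exact Finset.sum_congr rfl fun a _ => ih (fun i => k i.succ) fun y => hf _
    · rw [← sum_lexRank]
      exact Finset.sum_congr rfl fun y _ => cutCount_completeBinaryTree (k 0)
        (g := fun a => f (a * (List.ofFn fun i => k (Fin.succ i)).prod +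
          lexRank (fun i => k (Fin.succ i)) y)) fun a => hf _

theorem suffixProductSum_ofFn {d : ℕ} (k : Fin d → ℕ) :
    suffixProductSum (List.ofFn k) = Psi k d := by
  have h : ∀ {d : ℕ} (k : Fin d → ℕ), Psi k d = ∑ i : Fin d, ∏ j : Fin d with i < j, k j := by
    intro d k; simp [Psi]
  rw [h]
  induction d with
  | zero => simp [suffixProductSum]
  | succ d ih =>
    rw [List.ofFn_succ, suffixProductSum, ih, Fin.sum_univ_succ]
    congr 1
    · rw [Finset.prod_filter, Fin.prod_univ_succ, List.prod_ofFn]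
      simp
    · refine Finset.sum_congr rfl fun i _ => ?_
      rw [Finset.prod_filter, Finset.prod_filter, Fin.prod_univ_succ]
      simp

/-! ### The bisection width -/

theorem mainTheorem3 (d : ℕ) (k : Fin d → ℕ)
    (hk : ∀ i, ∃ l : ℕ, 2 ≤ l ∧ k i = 2 ^ l - 1) (hanti : Antitone k) :
    bisectionWidth (meshConnectedTrees k) = Psi k d := by
  classical
  have hform : ∀ j ∈ List.ofFn k, ∃ l, 2 ≤ l ∧ j = 2 ^ l - 1 := by
    intro j hj
    obtain ⟨i, rfl⟩ := List.mem_ofFn.1 hj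
    exact hk i
  have hodd : ∀ j ∈ List.ofFn k, 2 ≤ j ∧ Odd j := by
    intro j hj
    obtain ⟨l, hl, rfl⟩ := hform j hj
    refine ⟨?_, Nat.Even.sub_odd Nat.one_le_two_pow (Nat.even_pow.2 ⟨even_two, by omega⟩) odd_one⟩
    have : 2 ^ 2 ≤ 2 ^ l := Nat.pow_le_pow_right (by norm_num) hl
    omega
  -- For l > l', 2^l - 1 ≥ 2(2^l' - 1) + 1: distinct orders of complete binary trees differ by more
  -- than a factor of 2, which the two-factor case needs.
  have hpair : (List.ofFn k).Pairwise fun k h => k = h ∨ 2 * h + 1 ≤ k := by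
    rw [List.pairwise_ofFn]
    intro i j hij
    have hle := hanti hij.le
    obtain ⟨l, hl, hi⟩ := hk i
    obtain ⟨l', hl', hj⟩ := hk j
    have p1 : 1 ≤ 2 ^ l := Nat.one_le_two_pow
    have p2 : 1 ≤ 2 ^ l' := Nat.one_le_two_pow
    rcases Nat.lt_trichotomy l l' with h | h | h
    · have := Nat.pow_lt_pow_right (show 1 < 2 by norm_num) h
      omega
    · subst h; exact Or.inl (hi.trans hj.symm)
    · right
      have := Nat.pow_le_pow_right (show 0 < 2 by norm_num) (Nat.succ_le_of_lt h)
      rw [Nat.succ_eq_add_one, pow_succ] at this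
      omega
  have hcard : Fintype.card (∀ i, Fin (k i)) = (List.ofFn k).prod := by
    simp [List.prod_ofFn]
  have hleast := isLeast_bisectionWidth (meshConnectedTrees k)
  rw [← suffixProductSum_ofFn]
  apply le_antisymm
  · obtain ⟨f, hf, hs, hE⟩ := exists_bisection hform
    refine hleast.2 ⟨Finset.univ.filter fun x => f (lexRank k x) = 1, ?_, ?_⟩
    · rw [hcard, ← hs, ← sum_lexRank, Finset.card_filter]
      refine Finset.sum_congr rfl fun x _ => ?_
      have := hf (lexRank k x)
      interval_cases f (lexRank k x) <;> simp
    · rw [ncard_edgeBoundary_eq _ _ (χ := fun x => f (lexRank k x)) (by simp),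
        cutCount_meshConnectedTrees k hf, hE]
  · obtain ⟨S, hS, hm⟩ := hleast.1
    rw [← hm]
    let f : ℕ → ℕ := fun n => if ∃ x ∈ S, lexRank k x = n then 1 else 0
    have hf : ∀ n, f n ≤ 1 := fun n => by simp only [f]; split_ifs <;> simp
    have hfS : ∀ x, f (lexRank k x) = if x ∈ S then 1 else 0 := by
      intro x
      simp only [f, (lexRank_injective k).eq_iff, exists_eq_right]
    have hsum : ∑ n ∈ range (List.ofFn k).prod, f n = (List.ofFn k).prod / 2 := by
      rw [← sum_lexRank, ← hcard, ← hS]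
      simp [hfS]
    rw [ncard_edgeBoundary_eq _ S (χ := fun x => f (lexRank k x)) (by simp [hfS]),
      cutCount_meshConnectedTrees k hf]
    have h1 := belowOptimal_of_pairwise (fun j hj => (hodd j hj).1) hpair f hf
    rw [hsum, cliqueEnergy_below_half hodd] at h1
    exact_mod_cast h1.trans (cliqueEnergy_le_treeEnergy hodd hf)
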